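/- Conventions. For elements $x,y$ of a group, $[x,y]=x^{-1}y^{-1}xy$; $G'$ is the derived subgroup, $Z(G)$ the center, $\exp$ the exponent, and a $3$-generator group is a group whose minimal number of generators is $3$. A $2$-group is a group in which every element has order a power of $2$; it is not assumed to be finite. A $2\mathcal{E}$-group is a $2$-Engel $2$-group $G$ (that is, $[[x,y],y]=1$ for all $x,y\in G$) for which there is an integer $r\ge 0$ such that $\exp(G/G')=2^r$ and $\Omega_r(G)\le Z(G)$, where $\Omega_r(G)=\langle g\in G : g^{2^r}=1\rangle$. For integers $1\le t\le r$ and $[t_{ij}]\in GL(3,\mathbb{Z}/2^t\mathbb{Z})$, let $G(2,r,t,[t_{ij}])$ be the group with generators $x,y,z$ and relations $$x^{2^{r+t}}=y^{2^{r+t}}=z^{2^{r+t}}=1,$$ $$[x^{2^t},y]=[x^{2^t},z]=[y^{2^t},x]=[y^{2^t},z]=[z^{2^t},x]=[z^{2^t},y]=1,$$ $$[x,y]=x^{2^rt_{11}}y^{2^rt_{12}}z^{2^rt_{13}},\quad [x,z]=x^{2^rt_{21}}y^{2^rt_{22}}z^{2^rt_{23}},\quad [y,z]=x^{2^rt_{31}}y^{2^rt_{32}}z^{2^rt_{33}}.$$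 Theorem. Let $G$ be a non-abelian $3$-generator $2\mathcal{E}$-group such that $\exp(G/G')=\exp(G')=2^r$. Then $G$ is isomorphic to one of the following groups: (i) $Q_8\times C_2$; (ii) $\langle x,y,z \mid x^4=y^4=[y,z]=1,\ x^2=z^2=[x,y],\ (xz)^2=y^2\rangle$; (iii) $\langle x,y,z \mid x^4=z^4=[y,z]=1,\ x^2=y^2=[x,y],\ [x,z]=z^2\rangle$; (iv) $G(2,r,r,[t_{ij}])$ for some $[t_{ij}]\in GL(3,\mathbb{Z}/2^r\mathbb{Z})$, where $r\ge 1$. -/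

import Mathlib

namespace PEGroups

/-- The commutator with the convention `[x, y] = x⁻¹ y⁻¹ x y`. -/
def commElt {G : Type*} [Group G] (x y : G) : G := x⁻¹ * y⁻¹ * x * y

/-- A group is 2-Engel if `[x, y, y] = [[x, y], y] = 1` for all `x, y`. -/
def IsTwoEngel (G : Type*) [Group G] : Prop :=
  ∀ x y : G, commElt (commElt x y) y = 1

/-- The omega subgroup `Ω_r(G)` (for the prime `p`), generated by all elements whose order
divides `p ^ r`. -/
def omegaSubgroup (p r : ℕ) (G : Type*) [Group G] : Subgroup G :=
  Subgroup.closure {g : G | g ^ p ^ r = 1}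

/-- A `pℰ`-group (for a prime `p`): a 2-Engel `p`-group `G` for which there is a nonnegative
integer `r` with `exp(G / G') = p ^ r` and `Ω_r(G) ≤ Z(G)`. -/
structure IsPEGroup (p : ℕ) (G : Type*) [Group G] : Prop where
  isPGroup : IsPGroup p G
  twoEngel : IsTwoEngel G
  omega_le_center : ∃ r : ℕ, Monoid.exponent (G ⧸ commutator G) = p ^ r ∧
    omegaSubgroup p r G ≤ Subgroup.center G

/-- The first free generator. -/
def x : FreeGroup (Fin 3) := FreeGroup.of 0

/-- The second free generator. -/
def y : FreeGroup (Fin 3) := FreeGroup.of 1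

/-- The third free generator. -/
def z : FreeGroup (Fin 3) := FreeGroup.of 2

/-- `⟨x, y, z | x⁴ = y⁴ = [y,z] = 1, x² = z² = [x,y], (xz)² = y²⟩`.
A relation `u = v` is encoded by the relator `u * v⁻¹`. -/
abbrev GroupA : Type :=
  PresentedGroup ({x ^ 4, y ^ 4, commElt y z,
    x ^ 2 * (z ^ 2)⁻¹, z ^ 2 * (commElt x y)⁻¹,
    (x * z) ^ 2 * (y ^ 2)⁻¹} : Set (FreeGroup (Fin 3)))

/-- `⟨x, y, z | x⁴ = z⁴ = [y,z] = 1, x² = y² = [x,y], [x,z] = z²⟩`. -/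
abbrev GroupB : Type :=
  PresentedGroup ({x ^ 4, z ^ 4, commElt y z,
    x ^ 2 * (y ^ 2)⁻¹, y ^ 2 * (commElt x y)⁻¹,
    commElt x z * (z ^ 2)⁻¹} : Set (FreeGroup (Fin 3)))

/-- The word `x ^ (p^r t_{i1}) y ^ (p^r t_{i2}) z ^ (p^r t_{i3})` of row `i`. The residues
`t_{ij}` modulo `p ^ t` are represented by their least nonnegative representatives; the choice
does not matter where `x ^ p^(r+t) = y ^ p^(r+t) = z ^ p^(r+t) = 1`. -/
def rowWord (p r t : ℕ) (T : Matrix (Fin 3) (Fin 3) (ZMod (p ^ t))) (i : Fin 3) :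
    FreeGroup (Fin 3) :=
  x ^ (p ^ r * (T i 0).val) * y ^ (p ^ r * (T i 1).val) * z ^ (p ^ r * (T i 2).val)

/-- The group `G(p, r, t, [t_ij])`, for a prime `p`, integers `1 ≤ t ≤ r` and
`[t_ij] ∈ GL(3, ℤ / p^t)`. -/
abbrev GroupG (p r t : ℕ) (T : GL (Fin 3) (ZMod (p ^ t))) : Type :=
  PresentedGroup ({x ^ p ^ (r + t), y ^ p ^ (r + t), z ^ p ^ (r + t),
    commElt (x ^ p ^ t) y, commElt (x ^ p ^ t) z,
    commElt (y ^ p ^ t) x, commElt (y ^ p ^ t) z,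
    commElt (z ^ p ^ t) x, commElt (z ^ p ^ t) y,
    commElt x y * (rowWord p r t (T : Matrix (Fin 3) (Fin 3) (ZMod (p ^ t))) 0)⁻¹,
    commElt x z * (rowWord p r t (T : Matrix (Fin 3) (Fin 3) (ZMod (p ^ t))) 1)⁻¹,
    commElt y z * (rowWord p r t (T : Matrix (Fin 3) (Fin 3) (ZMod (p ^ t))) 2)⁻¹} :
    Set (FreeGroup (Fin 3)))

end PEGroups

/-! Since G' has exponent 2^r, it lies in Ω_r(G) and is therefore central. So commutators are
bilinear, 2^r-th powers lie in G', and elements killed by 2^r are central. `IsCritical` records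
these facts, and everything else follows from them. G' is generated by [x,y], [x,z], [y,z]. Type
(iv) arises when x^(2^r), y^(2^r), z^(2^r) and these commutators are two bases of G' ≅ (ℤ/2^r)^3;
the matrix T is the change of basis.

For r ≥ 2 this always happens. The value g^(2^r) depends only on gG'. If a member g of a generating
triple u, v, g had g^(2^(r-1)·2^r) = 1, then g^(2^(r-1)) would be central, and the 2^(r-1)-th powers
in G' would be 1 or [u,v]^(2^(r-1)). One of u, v, uv would then have a central 2^(r-1)-th power,
which forces exp(G') < 2^r (`pow_pred_ne_one_of_triple`). Hence the 2^r-th powers of the generators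
are independent, and counting finishes the case.

For r = 1, G/G' and G' are elementary abelian, and squaring is a quadratic map with polarization
[a,b]. If |G'| = 8, suitable generators have squares generating G' (`exists_triple_sq_generates`),
giving (iv). Otherwise some pair of generators y, z commutes (`exists_triple_commute`). If [x,y],
[x,z] are dependent, a generator can be made central and G is Q₈ × C₂. If they are independent, Z(G)
= G', so squares vanish only on G'; a check over 𝔽₂ (`squares_cases`) leaves (ii) and (iii).

Isomorphisms with presented groups come from normal forms x^i y^j z^k: a word trivial in G must also
be trivial by the relations alone (`nonempty_mulEquiv_presentedGroup`). -/

namespace PEGroups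

open Subgroup
open scoped commutatorElement

/-! ### Commutator calculus in nilpotency class two. -/

section ClassTwo

variable {G : Type*} [Group G]

lemma commutatorElement_mem_commutator (a b : G) : ⁅a, b⁆ ∈ commutator G :=
  commutator_mem_commutator (mem_top a) (mem_top b)

lemma commute_of_mem_center {c : G} (hc : c ∈ center G) (g : G) : Commute c g :=
  (mem_center_iff.mp hc g).symm

lemma commute_commutatorElement (hZ : commutator G ≤ center G) (a b g : G) :
    Commute ⁅a, b⁆ g :=
  commute_of_mem_center (hZ (commutatorElement_mem_commutator a b)) g

lemma commutatorElement_mul_left (hZ : commutator G ≤ center G) (a b c : G) :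
    ⁅a * b, c⁆ = ⁅a, c⁆ * ⁅b, c⁆ := by
  rw [commutatorElement_mul_left_eq_conj_mul, (commute_commutatorElement hZ b c a).symm.eq,
    mul_inv_cancel_right, (commute_commutatorElement hZ b c _).eq]

lemma commutatorElement_mul_right (hZ : commutator G ≤ center G) (a b c : G) :
    ⁅a, b * c⁆ = ⁅a, b⁆ * ⁅a, c⁆ := by
  rw [← commutatorElement_inv, commutatorElement_mul_left hZ, mul_inv_rev,
    commutatorElement_inv, commutatorElement_inv, (commute_commutatorElement hZ a c _).eq]

/-- In a group of nilpotency class at most two, commutation with a fixed element is a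
homomorphism. -/
def commutatorHom (hZ : commutator G ≤ center G) (c : G) : G →* G where
  toFun a := ⁅a, c⁆
  map_one' := commutatorElement_one_left c
  map_mul' a b := commutatorElement_mul_left hZ a b c

lemma commutatorElement_zpow_left (hZ : commutator G ≤ center G) (a c : G) (n : ℤ) :
    ⁅a ^ n, c⁆ = ⁅a, c⁆ ^ n :=
  map_zpow (commutatorHom hZ c) a n

lemma commutatorElement_pow_left (hZ : commutator G ≤ center G) (a c : G) (n : ℕ) :
    ⁅a ^ n, c⁆ = ⁅a, c⁆ ^ n :=
  map_pow (commutatorHom hZ c) a n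

lemma commutatorElement_zpow_right (hZ : commutator G ≤ center G) (a c : G) (n : ℤ) :
    ⁅a, c ^ n⁆ = ⁅a, c⁆ ^ n := by
  rw [← commutatorElement_inv, commutatorElement_zpow_left hZ, ← inv_zpow, commutatorElement_inv]

lemma commutatorElement_pow_right (hZ : commutator G ≤ center G) (a c : G) (n : ℕ) :
    ⁅a, c ^ n⁆ = ⁅a, c⁆ ^ n := by
  rw [← commutatorElement_inv, commutatorElement_pow_left hZ, ← inv_pow, commutatorElement_inv]

lemma commutatorElement_of_mem_center_left {c : G} (hc : c ∈ center G) (a : G) : ⁅c, a⁆ = 1 :=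
  commutatorElement_eq_one_iff_commute.mpr (commute_of_mem_center hc a)

lemma commutatorElement_of_mem_center_right {c : G} (hc : c ∈ center G) (a : G) : ⁅a, c⁆ = 1 :=
  commutatorElement_eq_one_iff_commute.mpr (commute_of_mem_center hc a).symm

/-- The derived subgroup of a group of nilpotency class at most two is commutative. -/
abbrev commutatorCommGroup (hZ : commutator G ≤ center G) : CommGroup (commutator G) :=
  { (inferInstance : Group (commutator G)) with
    mul_comm := fun a b => Subtype.ext (commute_of_mem_center (hZ a.2) b).eq }

/-- The two commutator conventions differ by inverting both arguments, and by bilinearity the two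
signs cancel. -/
lemma commElt_eq_commutatorElement (hZ : commutator G ≤ center G) (a b : G) :
    commElt a b = ⁅a, b⁆ := by
  have h : commElt a b = ⁅a⁻¹, b⁻¹⁆ := by simp [commElt, commutatorElement_def]
  rw [h, ← zpow_neg_one a, ← zpow_neg_one b, commutatorElement_zpow_left hZ,
    commutatorElement_zpow_right hZ]
  simp

lemma commElt_eq_one_iff (a b : G) : commElt a b = 1 ↔ Commute a b := by
  rw [commElt, show a⁻¹ * b⁻¹ * a * b = (b * a)⁻¹ * (a * b) by group, inv_mul_eq_one]
  exact eq_comm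

lemma mul_pow_of_class_two (hZ : commutator G ≤ center G) (a b : G) (n : ℕ) :
    (a * b) ^ n = a ^ n * b ^ n * ⁅b, a⁆ ^ n.choose 2 := by
  induction n with
  | zero => simp
  | succ n ih =>
    have hba : b ^ n * a = ⁅b, a⁆ ^ n * (a * b ^ n) := by
      rw [← commutatorElement_pow_left hZ, commutatorElement_def]; group
    have hc : ∀ (m : ℕ) (g : G), Commute (⁅b, a⁆ ^ m) g := fun m g =>
      (commute_commutatorElement hZ b a g).pow_left m
    rw [pow_succ, ih, Nat.choose_succ_succ' n 1, Nat.choose_one_right, pow_succ a,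
      pow_succ b, ← (hc (n.choose 2) (a ^ n * b ^ n)).eq]
    calc ⁅b, a⁆ ^ n.choose 2 * (a ^ n * b ^ n) * (a * b)
        = ⁅b, a⁆ ^ n.choose 2 * a ^ n * (b ^ n * a) * b := by group
      _ = ⁅b, a⁆ ^ n.choose 2 * (a ^ n * ⁅b, a⁆ ^ n) * (a * b ^ n) * b := by rw [hba]; group
      _ = (⁅b, a⁆ ^ n.choose 2 * ⁅b, a⁆ ^ n) * (a ^ n * a * (b ^ n * b)) := by
        rw [(hc n (a ^ n)).symm.eq]; group
      _ = _ := by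
        rw [← pow_add, (hc _ _).eq, add_comm]

end ClassTwo

/-! ### Groups generated by three elements. -/

section Generation

variable {G : Type*} [Group G]

lemma eq_top_of_triple {x y z : G} (hgen : closure {x, y, z} = ⊤) {N : Subgroup G}
    (hx : x ∈ N) (hy : y ∈ N) (hz : z ∈ N) : N = ⊤ := by
  rw [eq_top_iff, ← hgen, closure_le]
  rintro g (rfl | rfl | rfl) <;> assumption

lemma mem_center_of_triple {x y z : G} (hgen : closure {x, y, z} = ⊤) {g : G}
    (hx : Commute g x) (hy : Commute g y) (hz : Commute g z) : g ∈ center G := by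
  have h : centralizer {g} = ⊤ := eq_top_of_triple hgen
    (mem_centralizer_singleton_iff.mpr hx.symm) (mem_centralizer_singleton_iff.mpr hy.symm)
    (mem_centralizer_singleton_iff.mpr hz.symm)
  refine mem_center_iff.mpr fun a => ?_
  exact mem_centralizer_singleton_iff.mp (h ▸ mem_top a : a ∈ centralizer {g})

/-- N is normal because it is central. Modulo N each generator centralizes all three generators, so
G/N is abelian. -/
lemma commutator_le_of_triple {x y z : G} (hgen : closure {x, y, z} = ⊤) {N : Subgroup G}
    (hN : N ≤ center G) (hxy : ⁅x, y⁆ ∈ N) (hxz : ⁅x, z⁆ ∈ N) (hyz : ⁅y, z⁆ ∈ N) :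
    commutator G ≤ N := by
  have hnormal : N.Normal := ⟨fun a ha g => by
    rwa [← (commute_of_mem_center (hN ha) g).eq, mul_inv_cancel_right]⟩
  let Z : G → Subgroup G := fun g => (centralizer {(g : G ⧸ N)}).comap (QuotientGroup.mk' N)
  have hZ : ∀ {g a : G}, a ∈ Z g ↔ ⁅g, a⁆ ∈ N := by
    intro g a
    rw [mem_comap, mem_centralizer_singleton_iff, ← QuotientGroup.eq_one_iff]
    rw [show ((⁅g, a⁆ : G) : G ⧸ N) = ⁅(g : G ⧸ N), (a : G ⧸ N)⁆ from
      map_commutatorElement (QuotientGroup.mk' N) g a, commutatorElement_eq_one_iff_mul_comm]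
    exact eq_comm
  have hsymm : ∀ {g a : G}, ⁅g, a⁆ ∈ N → ⁅a, g⁆ ∈ N := fun {g a} h => by
    rw [← commutatorElement_inv]; exact inv_mem h
  have hself : ∀ g : G, ⁅g, g⁆ ∈ N := fun g => by simp
  have htop : ∀ {g : G}, ⁅g, x⁆ ∈ N → ⁅g, y⁆ ∈ N → ⁅g, z⁆ ∈ N → ∀ a, ⁅g, a⁆ ∈ N := by
    intro g h1 h2 h3 a
    have := eq_top_of_triple hgen (hZ.mpr h1) (hZ.mpr h2) (hZ.mpr h3)
    exact hZ.mp (this ▸ mem_top a)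
  rw [_root_.commutator_def, commutator_le]
  intro g _ a _
  exact htop (hsymm (htop (hself x) hxy hxz g)) (hsymm (htop (hsymm hxy) (hself y) hyz g))
    (hsymm (htop (hsymm hxz) (hsymm hyz) (hself z) g)) a

lemma exists_zpow_mul_mem_commutator {x y z : G} (hgen : closure {x, y, z} = ⊤) (g : G) :
    ∃ i j k : ℤ, ∃ c ∈ commutator G, g = x ^ i * y ^ j * z ^ k * c := by
  let o : G →* Abelianization G := Abelianization.of
  have h : ∃ i j k : ℤ, o g = o x ^ i * o y ^ j * o z ^ k := by
    have hg : g ∈ closure {x, y, z} := hgen ▸ mem_top g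
    induction hg using closure_induction with
    | mem g hg =>
      rcases hg with rfl | rfl | rfl
      · exact ⟨1, 0, 0, by simp⟩
      · exact ⟨0, 1, 0, by simp⟩
      · exact ⟨0, 0, 1, by simp⟩
    | one => exact ⟨0, 0, 0, by simp⟩
    | mul g h _ _ hg hh =>
      obtain ⟨i, j, k, hg⟩ := hg
      obtain ⟨i', j', k', hh⟩ := hh
      refine ⟨i + i', j + j', k + k', ?_⟩
      rw [map_mul, hg, hh, zpow_add, zpow_add, zpow_add, mul_mul_mul_comm, mul_mul_mul_comm (o x ^ i)]
    | inv g _ hg =>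
      obtain ⟨i, j, k, hg⟩ := hg
      refine ⟨-i, -j, -k, ?_⟩
      rw [map_inv, hg, mul_inv, mul_inv, zpow_neg, zpow_neg, zpow_neg]
  obtain ⟨i, j, k, h⟩ := h
  refine ⟨i, j, k, (x ^ i * y ^ j * z ^ k)⁻¹ * g, ?_, by group⟩
  rw [← Abelianization.ker_of G, MonoidHom.mem_ker]
  change o _ = 1
  simp only [map_mul, map_inv, map_zpow, h, inv_mul_cancel]

lemma exists_zpow_of_mem_closure_triple {a b c : G} (ha : a ∈ center G) (hb : b ∈ center G)
    (hc : c ∈ center G) {g : G} (hg : g ∈ closure {a, b, c}) :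
    ∃ i j k : ℤ, g = a ^ i * b ^ j * c ^ k := by
  have hle : closure {a, b, c} ≤ center G := by
    rw [closure_le]; rintro g (rfl | rfl | rfl) <;> assumption
  have hcomm : ∀ {u : G}, u ∈ center G → ∀ (n : ℤ) (v : G), u ^ n * v = v * u ^ n :=
    fun hu n v => (commute_of_mem_center (zpow_mem hu n) v).eq
  induction hg using closure_induction with
  | mem g hg =>
    rcases hg with rfl | rfl | rfl
    · exact ⟨1, 0, 0, by simp⟩
    · exact ⟨0, 1, 0, by simp⟩
    · exact ⟨0, 0, 1, by simp⟩
  | one => exact ⟨0, 0, 0, by simp⟩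
  | mul g h _ _ hg hh =>
    obtain ⟨i, j, k, hg⟩ := hg
    obtain ⟨i', j', k', hh⟩ := hh
    refine ⟨i + i', j + j', k + k', ?_⟩
    rw [hg, hh, zpow_add, zpow_add, zpow_add]
    calc a ^ i * b ^ j * c ^ k * (a ^ i' * b ^ j' * c ^ k')
        = a ^ i * b ^ j * (c ^ k * (a ^ i' * b ^ j')) * c ^ k' := by group
      _ = a ^ i * (b ^ j * a ^ i') * b ^ j' * c ^ k * c ^ k' := by rw [hcomm hc]; group
      _ = _ := by rw [hcomm hb]; group
  | inv g _ hg =>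
    obtain ⟨i, j, k, hg⟩ := hg
    refine ⟨-i, -j, -k, ?_⟩
    rw [hg, mul_inv_rev, mul_inv_rev, zpow_neg, zpow_neg, zpow_neg, ← zpow_neg c, hcomm hc,
      ← zpow_neg b, hcomm hb]

lemma exists_zpow_commutatorElement (hZ : commutator G ≤ center G) {x y z : G}
    (hgen : closure {x, y, z} = ⊤) {c : G} (hc : c ∈ commutator G) :
    ∃ i j k : ℤ, c = ⁅x, y⁆ ^ i * ⁅x, z⁆ ^ j * ⁅y, z⁆ ^ k := by
  have hle : closure {⁅x, y⁆, ⁅x, z⁆, ⁅y, z⁆} ≤ center G := by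
    rw [closure_le]
    rintro g (rfl | rfl | rfl) <;> exact hZ (commutatorElement_mem_commutator _ _)
  exact exists_zpow_of_mem_closure_triple (hZ (commutatorElement_mem_commutator x y))
    (hZ (commutatorElement_mem_commutator x z)) (hZ (commutatorElement_mem_commutator y z))
    (commutator_le_of_triple hgen hle (subset_closure (by simp)) (subset_closure (by simp))
      (subset_closure (by simp)) hc)

/-- If the `n`-th powers of the generators are central and the commutators of the generators are
generated by these powers, then every element is a product of powers of the generators. -/
lemma exists_zpow_of_pow_mem_center {x y z : G} {n : ℕ} (hgen : closure {x, y, z} = ⊤)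
    (hx : x ^ n ∈ center G) (hy : y ^ n ∈ center G) (hz : z ^ n ∈ center G)
    (hxy : ⁅x, y⁆ ∈ closure {x ^ n, y ^ n, z ^ n}) (hxz : ⁅x, z⁆ ∈ closure {x ^ n, y ^ n, z ^ n})
    (hyz : ⁅y, z⁆ ∈ closure {x ^ n, y ^ n, z ^ n}) (g : G) :
    ∃ i j k : ℤ, g = x ^ i * y ^ j * z ^ k := by
  have hle : closure {x ^ n, y ^ n, z ^ n} ≤ center G := by
    rw [closure_le]; rintro g (rfl | rfl | rfl) <;> assumption
  obtain ⟨i, j, k, c, hc, rfl⟩ := exists_zpow_mul_mem_commutator hgen g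
  obtain ⟨i', j', k', rfl⟩ := exists_zpow_of_mem_closure_triple hx hy hz
    (commutator_le_of_triple hgen hle hxy hxz hyz hc)
  have hcomm : ∀ {u : G}, u ∈ center G → ∀ (n : ℤ) (v : G), v * u ^ n = u ^ n * v :=
    fun hu n v => (commute_of_mem_center (zpow_mem hu n) v).eq.symm
  refine ⟨i + n * i', j + n * j', k + n * k', ?_⟩
  rw [zpow_add, zpow_add, zpow_add, zpow_mul, zpow_mul, zpow_mul, zpow_natCast, zpow_natCast,
    zpow_natCast]
  calc x ^ i * y ^ j * z ^ k * ((x ^ n) ^ i' * (y ^ n) ^ j' * (z ^ n) ^ k')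
      = x ^ i * (y ^ j * z ^ k * (x ^ n) ^ i') * (y ^ n) ^ j' * (z ^ n) ^ k' := by group
    _ = x ^ i * (x ^ n) ^ i' * y ^ j * (z ^ k * (y ^ n) ^ j') * (z ^ n) ^ k' := by
      rw [hcomm hx]; group
    _ = _ := by rw [hcomm hy]; group

/-- A surjective homomorphism that is injective on products of powers of generators is an
isomorphism. -/
lemma nonempty_mulEquiv_of_triple {H : Type*} [Group H] (φ : H →* G) {X Y Z : H}
    (hgen : closure {φ X, φ Y, φ Z} = ⊤) (hH : ∀ h : H, ∃ i j k : ℤ, h = X ^ i * Y ^ j * Z ^ k)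
    (hinj : ∀ i j k : ℤ, φ X ^ i * φ Y ^ j * φ Z ^ k = 1 → X ^ i * Y ^ j * Z ^ k = 1) :
    Nonempty (G ≃* H) := by
  refine ⟨(MulEquiv.ofBijective φ ⟨?_, ?_⟩).symm⟩
  · rw [injective_iff_map_eq_one]
    intro h hh
    obtain ⟨i, j, k, rfl⟩ := hH h
    exact hinj i j k (by simpa using hh)
  · rw [← MonoidHom.range_eq_top]
    exact eq_top_of_triple hgen ⟨X, rfl⟩ ⟨Y, rfl⟩ ⟨Z, rfl⟩

end Generation

/-! ### Change-of-basis matrices and recognition of presented groups. -/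

section Presentation

/-- Two generating families of a free module of finite cardinality, indexed by a basis, differ by an
invertible matrix. -/
lemma exists_GL_of_spanning {R M ι : Type*} [CommRing R] [Finite R] [AddCommGroup M] [Module R M]
    [Fintype ι] [DecidableEq ι] (hcard : Nat.card M = Nat.card R ^ Fintype.card ι) (b c : ι → M)
    (hb : ∀ a, ∃ v : ι → R, ∑ i, v i • b i = a) (hc : ∀ a, ∃ v : ι → R, ∑ i, v i • c i = a) :
    (∃ T : GL ι R, ∀ i, c i = ∑ j, (T : Matrix ι ι R) i j • b j) ∧
      ∀ v : ι → R, ∑ i, v i • b i = 0 → v = 0 := by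
  have hbij : ∀ b : ι → M, (∀ a, ∃ v : ι → R, ∑ i, v i • b i = a) →
      Function.Bijective (Fintype.linearCombination R b) := by
    intro b hb
    have hsurj : Function.Surjective (Fintype.linearCombination R b) := fun a => by
      simpa only [Fintype.linearCombination_apply] using hb a
    -- A surjection between finite sets of equal size is injective, so a generating family of the
    -- right length is a basis.
    refine hsurj.bijective_of_nat_card_le ?_
    rw [hcard, Nat.card_fun, Nat.card_eq_fintype_card (α := ι)]
  let e := (LinearEquiv.ofBijective _ (hbij c hc)).trans (LinearEquiv.ofBijective _ (hbij b hb)).symm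
  -- The transpose is needed because the coordinates of `c i` are to form row `i`, whereas
  -- `toMatrix'` puts them in a column.
  have hdet : IsUnit (LinearMap.toMatrix' e.toLinearMap).transpose.det := by
    rw [Matrix.det_transpose, LinearMap.det_toMatrix']
    exact LinearEquiv.isUnit_det' e
  refine ⟨⟨Matrix.GeneralLinearGroup.mk'' _ hdet, fun i => ?_⟩, fun v h => ?_⟩
  · have h1 : Fintype.linearCombination R b (e (Pi.single i 1)) =
        Fintype.linearCombination R c (Pi.single i 1) :=
      LinearEquiv.apply_symm_apply (LinearEquiv.ofBijective _ (hbij b hb)) _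
    rw [Fintype.linearCombination_apply_single, one_smul] at h1
    rw [← h1, Fintype.linearCombination_apply]
    refine Finset.sum_congr rfl fun j _ => ?_
    rw [show (Matrix.GeneralLinearGroup.mk'' _ hdet : Matrix ι ι R) i j =
      LinearMap.toMatrix' e.toLinearMap j i from rfl, LinearMap.toMatrix'_apply]
    rfl
  · refine (hbij b hb).1 ?_
    rw [map_zero, Fintype.linearCombination_apply, h]

/-- Two generating triples of a free `ℤ/n`-module of rank three, written multiplicatively, differ by
an invertible matrix. -/
lemma exists_GL_of_generating_triples {A : Type*} [CommGroup A] {n : ℕ} [NeZero n]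
    (he : ∀ a : A, a ^ n = 1) (hcard : Nat.card A = n ^ 3) (b c : Fin 3 → A)
    (hb : ∀ a, ∃ i j k : ℤ, a = b 0 ^ i * b 1 ^ j * b 2 ^ k)
    (hc : ∀ a, ∃ i j k : ℤ, a = c 0 ^ i * c 1 ^ j * c 2 ^ k) :
    (∃ T : GL (Fin 3) (ZMod n), ∀ i,
      c i = b 0 ^ ((T : Matrix (Fin 3) (Fin 3) (ZMod n)) i 0).val *
        b 1 ^ ((T : Matrix (Fin 3) (Fin 3) (ZMod n)) i 1).val *
        b 2 ^ ((T : Matrix (Fin 3) (Fin 3) (ZMod n)) i 2).val) ∧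
    ∀ i j k : ℤ, b 0 ^ i * b 1 ^ j * b 2 ^ k = 1 → (n : ℤ) ∣ i ∧ (n : ℤ) ∣ j ∧ (n : ℤ) ∣ k := by
  let : Module (ZMod n) (Additive A) := AddCommGroup.zmodModule fun a => he a.toMul
  have hval : ∀ (m : ZMod n) (a : A), m • Additive.ofMul a = Additive.ofMul (a ^ m.val) := by
    intro m a
    conv_lhs => rw [← ZMod.natCast_zmod_val m]
    rw [Nat.cast_smul_eq_nsmul, ofMul_pow]
  have hint : ∀ (b : Fin 3 → A) (i j k : ℤ),
      ∑ l, (![(i : ZMod n), (j : ZMod n), (k : ZMod n)]) l • Additive.ofMul (b l) =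
        Additive.ofMul (b 0 ^ i * b 1 ^ j * b 2 ^ k) := by
    intro b i j k
    simp [Fin.sum_univ_three, Int.cast_smul_eq_zsmul]
  have hspan : ∀ b : Fin 3 → A, (∀ a, ∃ i j k : ℤ, a = b 0 ^ i * b 1 ^ j * b 2 ^ k) →
      ∀ a, ∃ v : Fin 3 → ZMod n, ∑ l, v l • Additive.ofMul (b l) = a := fun b hb a => by
    obtain ⟨i, j, k, h⟩ := hb a.toMul
    exact ⟨_, (hint b i j k).trans (congrArg Additive.ofMul h.symm)⟩
  obtain ⟨⟨T, hT⟩, hinj⟩ := exists_GL_of_spanning (R := ZMod n) (M := Additive A) (ι := Fin 3)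
    (by rw [Nat.card_congr Additive.toMul, hcard]; simp) (fun i => Additive.ofMul (b i))
    (fun i => Additive.ofMul (c i)) (hspan b hb) (hspan c hc)
  refine ⟨⟨T, fun i => Additive.ofMul.injective ((hT i).trans ?_)⟩, fun i j k h => ?_⟩
  · simp only [Fin.sum_univ_three, hval, ofMul_mul]
  · have h2 := hinj _ ((hint b i j k).trans (by rw [h, ofMul_one]))
    simp only [← ZMod.intCast_zmod_eq_zero_iff_dvd]
    exact ⟨congrFun h2 0, congrFun h2 1, congrFun h2 2⟩

variable {G : Type*} [Group G]

/-- Recognition of a presented group on three generators: it suffices that in every group satisfying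
the relations all elements are products of powers of the generators, and that such a product is
trivial as soon as it is trivial in the given group. -/
lemma nonempty_mulEquiv_presentedGroup {rels : Set (FreeGroup (Fin 3))} {x y z : G}
    (hgen : closure {x, y, z} = ⊤) (hrel : ∀ w ∈ rels, FreeGroup.lift ![x, y, z] w = 1)
    (huniv : ∀ {H : Type} [Group H] (X Y Z : H), closure {X, Y, Z} = ⊤ →
      (∀ w ∈ rels, FreeGroup.lift ![X, Y, Z] w = 1) →
      (∀ h : H, ∃ i j k : ℤ, h = X ^ i * Y ^ j * Z ^ k) ∧
      ∀ i j k : ℤ, x ^ i * y ^ j * z ^ k = 1 → X ^ i * Y ^ j * Z ^ k = 1) :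
    Nonempty (G ≃* PresentedGroup rels) := by
  have hgenH : closure {(PresentedGroup.of 0 : PresentedGroup rels), PresentedGroup.of 1,
      PresentedGroup.of 2} = ⊤ := by
    rw [← PresentedGroup.closure_range_of]
    congr 1
    ext g
    simp [Fin.exists_fin_succ, eq_comm]
  have hmk : FreeGroup.lift ![(PresentedGroup.of 0 : PresentedGroup rels), PresentedGroup.of 1,
      PresentedGroup.of 2] = PresentedGroup.mk rels := by
    ext i
    fin_cases i <;> simp [PresentedGroup.of]
  obtain ⟨h1, h2⟩ := huniv _ _ _ hgenH fun w hw => by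
    rw [hmk]
    exact (QuotientGroup.eq_one_iff w).mpr (subset_normalClosure hw)
  have h3 := fun i => PresentedGroup.toGroup.of (x := i) hrel
  refine nonempty_mulEquiv_of_triple (PresentedGroup.toGroup hrel) ?_ h1 ?_
  · rw [h3, h3, h3]
    exact hgen
  · rw [h3, h3, h3]
    exact h2

lemma map_commElt {H : Type*} [Group H] (φ : G →* H) (a b : G) :
    φ (commElt a b) = commElt (φ a) (φ b) := by
  simp [commElt]

/-- The two commutators are conjugate, so no bound on the class is needed. This matters for the
presented group, whose class is not yet known. -/
lemma commElt_mem_iff {N : Subgroup G} (hN : N ≤ center G) (a b : G) :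
    commElt a b ∈ N ↔ ⁅a, b⁆ ∈ N := by
  have h : ⁅a, b⁆ = (b * a) * commElt a b * (b * a)⁻¹ := by
    rw [commutatorElement_def, commElt]; group
  constructor
  · intro hc
    rwa [h, ← (commute_of_mem_center (hN hc) _).eq, mul_inv_cancel_right]
  · intro hc
    have h' : commElt a b = (b * a)⁻¹ * (⁅a, b⁆ * (b * a)) := by rw [h]; group
    rwa [h', (commute_of_mem_center (hN hc) _).eq, inv_mul_cancel_left]

/-- The value of the word in row `i` of the presentation of `G(2, r, r, [t_ij])`. -/
def rowValue {r : ℕ} (T : Matrix (Fin 3) (Fin 3) (ZMod (2 ^ r))) (x y z : G) (i : Fin 3) : G :=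
  x ^ (2 ^ r * (T i 0).val) * y ^ (2 ^ r * (T i 1).val) * z ^ (2 ^ r * (T i 2).val)

/-- The relators of `G(2, r, r, [t_ij])`. -/
def groupGRels {r : ℕ} (T : Matrix (Fin 3) (Fin 3) (ZMod (2 ^ r))) : Set (FreeGroup (Fin 3)) :=
  {x ^ 2 ^ (r + r), y ^ 2 ^ (r + r), z ^ 2 ^ (r + r),
    commElt (x ^ 2 ^ r) y, commElt (x ^ 2 ^ r) z,
    commElt (y ^ 2 ^ r) x, commElt (y ^ 2 ^ r) z,
    commElt (z ^ 2 ^ r) x, commElt (z ^ 2 ^ r) y,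
    commElt x y * (rowWord 2 r r T 0)⁻¹,
    commElt x z * (rowWord 2 r r T 1)⁻¹,
    commElt y z * (rowWord 2 r r T 2)⁻¹}

lemma forall_groupGRels_iff {r : ℕ} (T : Matrix (Fin 3) (Fin 3) (ZMod (2 ^ r))) (a b c : G) :
    (∀ w ∈ groupGRels T, FreeGroup.lift ![a, b, c] w = 1) ↔
      a ^ 2 ^ (r + r) = 1 ∧ b ^ 2 ^ (r + r) = 1 ∧ c ^ 2 ^ (r + r) = 1 ∧
      Commute (a ^ 2 ^ r) b ∧ Commute (a ^ 2 ^ r) c ∧ Commute (b ^ 2 ^ r) a ∧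
      Commute (b ^ 2 ^ r) c ∧ Commute (c ^ 2 ^ r) a ∧ Commute (c ^ 2 ^ r) b ∧
      commElt a b = rowValue T a b c 0 ∧ commElt a c = rowValue T a b c 1 ∧
      commElt b c = rowValue T a b c 2 := by
  simp only [groupGRels, Set.mem_insert_iff, Set.mem_singleton_iff, forall_eq_or_imp, forall_eq,
    map_pow, map_mul, map_inv, map_commElt, rowWord, rowValue, mul_inv_eq_one, commElt_eq_one_iff,
    PEGroups.x, PEGroups.y, PEGroups.z, FreeGroup.lift_apply_of, Matrix.cons_val]

/-- Recognition of the groups `G(2, r, r, [t_ij])` from their relations. -/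
lemma nonempty_mulEquiv_groupG {r : ℕ} {x y z : G} (hgen : closure {x, y, z} = ⊤)
    (hx : x ^ 2 ^ (r + r) = 1) (hy : y ^ 2 ^ (r + r) = 1) (hz : z ^ 2 ^ (r + r) = 1)
    (hxZ : x ^ 2 ^ r ∈ center G) (hyZ : y ^ 2 ^ r ∈ center G) (hzZ : z ^ 2 ^ r ∈ center G)
    (T : GL (Fin 3) (ZMod (2 ^ r)))
    (hT0 : commElt x y = rowValue (T : Matrix (Fin 3) (Fin 3) (ZMod (2 ^ r))) x y z 0)
    (hT1 : commElt x z = rowValue (T : Matrix (Fin 3) (Fin 3) (ZMod (2 ^ r))) x y z 1)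
    (hT2 : commElt y z = rowValue (T : Matrix (Fin 3) (Fin 3) (ZMod (2 ^ r))) x y z 2)
    (hind : ∀ i j k : ℤ, x ^ i * y ^ j * z ^ k = 1 → ((2 ^ (r + r) : ℕ) : ℤ) ∣ i ∧
      ((2 ^ (r + r) : ℕ) : ℤ) ∣ j ∧ ((2 ^ (r + r) : ℕ) : ℤ) ∣ k) :
    Nonempty (G ≃* GroupG 2 r r T) := by
  refine nonempty_mulEquiv_presentedGroup (rels := groupGRels _) hgen
    ((forall_groupGRels_iff _ _ _ _).mpr ⟨hx, hy, hz, commute_of_mem_center hxZ _,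
      commute_of_mem_center hxZ _, commute_of_mem_center hyZ _, commute_of_mem_center hyZ _,
      commute_of_mem_center hzZ _, commute_of_mem_center hzZ _, hT0, hT1, hT2⟩)
    fun {H} _ X Y Z hgenH hrel => ?_
  obtain ⟨hX, hY, hZ, hXY, hXZ, hYX, hYZ, hZX, hZY, h0, h1, h2⟩ :=
    (forall_groupGRels_iff _ _ _ _).mp hrel
  have hXc : X ^ 2 ^ r ∈ center H :=
    mem_center_of_triple hgenH (Commute.refl X |>.pow_left _) hXY hXZ
  have hYc : Y ^ 2 ^ r ∈ center H :=
    mem_center_of_triple hgenH hYX (Commute.refl Y |>.pow_left _) hYZ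
  have hZc : Z ^ 2 ^ r ∈ center H :=
    mem_center_of_triple hgenH hZX hZY (Commute.refl Z |>.pow_left _)
  have hle : closure {X ^ 2 ^ r, Y ^ 2 ^ r, Z ^ 2 ^ r} ≤ center H := by
    rw [closure_le]; rintro g (rfl | rfl | rfl) <;> assumption
  have hword : ∀ i, rowValue (T : Matrix (Fin 3) (Fin 3) (ZMod (2 ^ r))) X Y Z i ∈
      closure {X ^ 2 ^ r, Y ^ 2 ^ r, Z ^ 2 ^ r} := by
    intro i
    rw [rowValue, pow_mul, pow_mul, pow_mul]
    exact mul_mem (mul_mem (pow_mem (subset_closure (by simp)) _)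
      (pow_mem (subset_closure (by simp)) _)) (pow_mem (subset_closure (by simp)) _)
  refine ⟨exists_zpow_of_pow_mem_center hgenH hXc hYc hZc
    ((commElt_mem_iff hle _ _).mp (h0 ▸ hword _)) ((commElt_mem_iff hle _ _).mp (h1 ▸ hword _))
    ((commElt_mem_iff hle _ _).mp (h2 ▸ hword _)), fun i j k h => ?_⟩
  obtain ⟨⟨i', rfl⟩, ⟨j', rfl⟩, ⟨k', rfl⟩⟩ := hind i j k h
  rw [zpow_mul, zpow_mul, zpow_mul, zpow_natCast, zpow_natCast, zpow_natCast, hX, hY, hZ]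
  simp

/-- Recognition of the groups `G(2, r, r, [t_ij])`. -/
theorem exists_mulEquiv_groupG {r : ℕ} (hZ : commutator G ≤ center G)
    (he : ∀ c ∈ commutator G, c ^ 2 ^ r = 1) {x y z : G} (hgen : closure {x, y, z} = ⊤)
    (hx : x ^ 2 ^ r ∈ commutator G) (hy : y ^ 2 ^ r ∈ commutator G)
    (hz : z ^ 2 ^ r ∈ commutator G)
    (hind : ∀ i j k : ℤ, x ^ i * y ^ j * z ^ k ∈ commutator G →
      ((2 ^ r : ℕ) : ℤ) ∣ i ∧ ((2 ^ r : ℕ) : ℤ) ∣ j ∧ ((2 ^ r : ℕ) : ℤ) ∣ k)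
    (hcard : Nat.card (commutator G) = (2 ^ r) ^ 3)
    (hspan : commutator G ≤ closure {x ^ 2 ^ r, y ^ 2 ^ r, z ^ 2 ^ r}) :
    ∃ T : GL (Fin 3) (ZMod (2 ^ r)), Nonempty (G ≃* GroupG 2 r r T) := by
  let : CommGroup (commutator G) := commutatorCommGroup hZ
  obtain ⟨⟨T, hT⟩, hB⟩ := exists_GL_of_generating_triples (A := commutator G) (n := 2 ^ r)
    (fun a => Subtype.ext (he a a.2)) hcard
    ![⟨x ^ 2 ^ r, hx⟩, ⟨y ^ 2 ^ r, hy⟩, ⟨z ^ 2 ^ r, hz⟩]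
    ![⟨⁅x, y⁆, commutatorElement_mem_commutator x y⟩,
      ⟨⁅x, z⁆, commutatorElement_mem_commutator x z⟩,
      ⟨⁅y, z⁆, commutatorElement_mem_commutator y z⟩]
    (fun a => by
      obtain ⟨i, j, k, h⟩ := exists_zpow_of_mem_closure_triple (hZ hx) (hZ hy) (hZ hz) (hspan a.2)
      exact ⟨i, j, k, Subtype.ext h⟩)
    (fun a => by
      obtain ⟨i, j, k, h⟩ := exists_zpow_commutatorElement hZ hgen a.2
      exact ⟨i, j, k, Subtype.ext h⟩)
  have hB' : ∀ i j k : ℤ, (x ^ 2 ^ r) ^ i * (y ^ 2 ^ r) ^ j * (z ^ 2 ^ r) ^ k = 1 →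
      ((2 ^ r : ℕ) : ℤ) ∣ i ∧ ((2 ^ r : ℕ) : ℤ) ∣ j ∧ ((2 ^ r : ℕ) : ℤ) ∣ k :=
    fun i j k h => hB i j k (Subtype.ext h)
  have hT0 := congrArg Subtype.val (hT 0)
  have hT1 := congrArg Subtype.val (hT 1)
  have hT2 := congrArg Subtype.val (hT 2)
  simp only [Matrix.cons_val, Subgroup.coe_mul, Subgroup.coe_pow] at hT0 hT1 hT2
  clear hT hB
  have hpow : ∀ {g : G}, g ^ 2 ^ r ∈ commutator G → g ^ 2 ^ (r + r) = 1 := fun hg => by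
    rw [pow_add, pow_mul, he _ hg]
  refine ⟨T, nonempty_mulEquiv_groupG hgen (hpow hx) (hpow hy) (hpow hz) (hZ hx) (hZ hy) (hZ hz) T
    ?_ ?_ ?_ fun i j k h => ?_⟩
  · rw [commElt_eq_commutatorElement hZ, rowValue, pow_mul, pow_mul, pow_mul]; exact hT0
  · rw [commElt_eq_commutatorElement hZ, rowValue, pow_mul, pow_mul, pow_mul]; exact hT1
  · rw [commElt_eq_commutatorElement hZ, rowValue, pow_mul, pow_mul, pow_mul]; exact hT2
  -- One factor 2^r of each exponent comes from independence modulo G', the other from independence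
  -- of the 2^r-th powers inside G'.
  · obtain ⟨⟨i', rfl⟩, ⟨j', rfl⟩, ⟨k', rfl⟩⟩ := hind i j k (h ▸ one_mem _)
    simp only [zpow_mul, zpow_natCast] at h
    obtain ⟨h1, h2, h3⟩ := hB' _ _ _ h
    rw [pow_add, Nat.cast_mul]
    exact ⟨mul_dvd_mul_left _ h1, mul_dvd_mul_left _ h2, mul_dvd_mul_left _ h3⟩

end Presentation

/-! ### Independent triples in a three-generated abelian group of exponent n. -/

section Counting

/-- An independent triple in an abelian group of exponent `n` generated by three elements is a
basis. -/
lemma card_eq_and_generates_of_independent {A : Type*} [CommGroup A] {n : ℕ} [NeZero n]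
    (he : ∀ a : A, a ^ n = 1) (b c : Fin 3 → A)
    (hb : ∀ i j k : ℤ, b 0 ^ i * b 1 ^ j * b 2 ^ k = 1 →
      (n : ℤ) ∣ i ∧ (n : ℤ) ∣ j ∧ (n : ℤ) ∣ k)
    (hc : ∀ a, ∃ i j k : ℤ, a = c 0 ^ i * c 1 ^ j * c 2 ^ k) :
    Nat.card A = n ^ 3 ∧ ∀ a, ∃ i j k : ℤ, a = b 0 ^ i * b 1 ^ j * b 2 ^ k := by
  have hmod : ∀ (a : A) (i : ℤ), a ^ (i % n) = a ^ i := fun a i => by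
    conv_rhs => rw [← Int.emod_add_mul_ediv i n, zpow_add, zpow_mul, zpow_natCast, he, one_zpow,
      mul_one]
  let f : (Fin 3 → A) → Fin n × Fin n × Fin n → A := fun b v =>
    b 0 ^ (v.1 : ℕ) * b 1 ^ (v.2.1 : ℕ) * b 2 ^ (v.2.2 : ℕ)
  have hcard : Nat.card (Fin n × Fin n × Fin n) = n ^ 3 := by
    simp only [Nat.card_prod, Nat.card_fin]; ring
  have hsurj : Function.Surjective (f c) := by
    intro a
    obtain ⟨i, j, k, rfl⟩ := hc a
    have hn : (n : ℤ) ≠ 0 := by exact_mod_cast NeZero.ne n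
    have hpos : (0 : ℤ) < n := by have := NeZero.pos n; omega
    have hfin : ∀ i : ℤ, ∃ m : Fin n, ((m : ℕ) : ℤ) = i % n := fun i =>
      ⟨⟨(i % n).toNat, by have := Int.emod_lt_of_pos i hpos; have := Int.emod_nonneg i hn; omega⟩,
        Int.toNat_of_nonneg (Int.emod_nonneg i hn)⟩
    obtain ⟨i', hi⟩ := hfin i
    obtain ⟨j', hj⟩ := hfin j
    obtain ⟨k', hk⟩ := hfin k
    refine ⟨(i', j', k'), ?_⟩
    simp only [f, ← zpow_natCast, hi, hj, hk, hmod]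
  have hinj : Function.Injective (f b) := by
    rintro ⟨i, j, k⟩ ⟨i', j', k'⟩ h
    have h1 : b 0 ^ ((i : ℤ) - i') * b 1 ^ ((j : ℤ) - j') * b 2 ^ ((k : ℤ) - k') = 1 := by
      simp only [f, ← zpow_natCast] at h
      rw [zpow_sub, zpow_sub, zpow_sub, ← mul_inv_eq_one.mpr h]
      simp only [mul_inv]
      ac_rfl
    obtain ⟨h2, h3, h4⟩ := hb _ _ _ h1
    have hdiff : ∀ i i' : Fin n, (n : ℤ) ∣ (i : ℤ) - i' → i = i' := fun i i' h => by
      have := Int.eq_zero_of_abs_lt_dvd h (by rw [abs_lt]; omega)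
      ext; omega
    rw [hdiff _ _ h2, hdiff _ _ h3, hdiff _ _ h4]
  -- Generation by `c` gives |A| ≤ n³ and independence of `b` gives |A| ≥ n³. Equality makes the
  -- injective map of `b` surjective.
  have : Finite A := Finite.of_surjective _ hsurj
  have hle := Nat.card_le_card_of_surjective _ hsurj
  have hge := Nat.card_le_card_of_injective _ hinj
  rw [hcard] at hle hge
  refine ⟨le_antisymm hle hge, fun a => ?_⟩
  obtain ⟨⟨i, j, k⟩, h⟩ := (hinj.bijective_of_nat_card_le (hcard ▸ hle)).2 a
  exact ⟨i, j, k, by simpa [f] using h.symm⟩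

end Counting

/-! ### Exchange of generators modulo the derived subgroup. -/

section Exchange

variable {G : Type*} [Group G]

/-- Central factors do not affect commutators, so every commutator of G is already a commutator of
elements of H. Generation can thus be tested modulo G'. -/
lemma eq_top_of_sup_commutator_eq_top (hZ : commutator G ≤ center G) {H : Subgroup G}
    (h : H ⊔ commutator G = ⊤) : H = ⊤ := by
  rw [← h, left_eq_sup, _root_.commutator_def, commutator_le]
  have hdec : ∀ g : G, ∃ a ∈ H, ∃ c ∈ commutator G, a * c = g := fun g =>
    mem_sup_of_normal_right.mp (h ▸ mem_top g)
  intro g _ g' _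
  obtain ⟨a, ha, c, hc, rfl⟩ := hdec g
  obtain ⟨a', ha', c', hc', rfl⟩ := hdec g'
  rw [commutatorElement_mul_left hZ, commutatorElement_of_mem_center_left (hZ hc), mul_one,
    commutatorElement_mul_right hZ, commutatorElement_of_mem_center_right (hZ hc'), mul_one,
    commutatorElement_def]
  exact mul_mem (mul_mem (mul_mem ha ha') (inv_mem ha)) (inv_mem ha')

/-- An odd exponent is invertible modulo the order 2^m, by Bézout. -/
lemma mem_of_zpow_mem_of_odd {g : G} {m : ℕ} (hg : g ^ 2 ^ m = 1) {i : ℤ} (hi : Odd i)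
    {H : Subgroup G} (h : g ^ i ∈ H) : g ∈ H := by
  have hcop : IsCoprime i (2 ^ m) := by
    refine IsCoprime.pow_right ?_
    obtain ⟨k, rfl⟩ := hi
    exact ⟨1, -k, by ring⟩
  obtain ⟨a, b, hab⟩ := hcop
  have : g = (g ^ i) ^ a := by
    rw [← zpow_mul, mul_comm]
    conv_lhs => rw [← zpow_one g, ← hab, zpow_add, mul_comm b, zpow_mul g (2 ^ m),
      show ((2 : ℤ) ^ m) = ((2 ^ m : ℕ) : ℤ) by push_cast; rfl, zpow_natCast, hg, one_zpow, mul_one]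
  rw [this]
  exact zpow_mem h a

/-- Modulo G' an odd power of x can be solved for in terms of g, y, z, and x is a power of that odd
power. The next two lemmas do the same for y and z. -/
lemma closure_exchange_left (hZ : commutator G ≤ center G) {x y z : G}
    (hgen : closure {x, y, z} = ⊤) {m : ℕ} (hx : x ^ 2 ^ m = 1) {i j k : ℤ} (hi : Odd i) {c g : G}
    (hc : c ∈ commutator G) (hg : g = x ^ i * y ^ j * z ^ k * c) : closure {g, y, z} = ⊤ := by
  refine eq_top_of_sup_commutator_eq_top hZ ?_
  have hy : y ∈ closure {g, y, z} ⊔ commutator G := mem_sup_left (subset_closure (by simp))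
  have hz : z ∈ closure {g, y, z} ⊔ commutator G := mem_sup_left (subset_closure (by simp))
  refine eq_top_of_triple hgen (mem_of_zpow_mem_of_odd hx hi ?_) hy hz
  rw [show x ^ i = g * c⁻¹ * (z ^ k)⁻¹ * (y ^ j)⁻¹ by rw [hg]; group]
  exact mul_mem (mul_mem (mul_mem (mem_sup_left (subset_closure (by simp)))
    (inv_mem (mem_sup_right hc))) (inv_mem (zpow_mem hz _))) (inv_mem (zpow_mem hy _))

lemma closure_exchange_middle (hZ : commutator G ≤ center G) {x y z : G}
    (hgen : closure {x, y, z} = ⊤) {m : ℕ} (hy : y ^ 2 ^ m = 1) {i j k : ℤ} (hj : Odd j) {c g : G}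
    (hc : c ∈ commutator G) (hg : g = x ^ i * y ^ j * z ^ k * c) : closure {x, g, z} = ⊤ := by
  refine eq_top_of_sup_commutator_eq_top hZ ?_
  have hx : x ∈ closure {x, g, z} ⊔ commutator G := mem_sup_left (subset_closure (by simp))
  have hz : z ∈ closure {x, g, z} ⊔ commutator G := mem_sup_left (subset_closure (by simp))
  refine eq_top_of_triple hgen hx (mem_of_zpow_mem_of_odd hy hj ?_) hz
  rw [show y ^ j = (x ^ i)⁻¹ * (g * c⁻¹ * (z ^ k)⁻¹) by rw [hg]; group]
  exact mul_mem (inv_mem (zpow_mem hx _)) (mul_mem (mul_mem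
    (mem_sup_left (subset_closure (by simp))) (inv_mem (mem_sup_right hc)))
    (inv_mem (zpow_mem hz _)))

lemma closure_exchange_right (hZ : commutator G ≤ center G) {x y z : G}
    (hgen : closure {x, y, z} = ⊤) {m : ℕ} (hz : z ^ 2 ^ m = 1) {i j k : ℤ} (hk : Odd k) {c g : G}
    (hc : c ∈ commutator G) (hg : g = x ^ i * y ^ j * z ^ k * c) : closure {x, y, g} = ⊤ := by
  refine eq_top_of_sup_commutator_eq_top hZ ?_
  have hx : x ∈ closure {x, y, g} ⊔ commutator G := mem_sup_left (subset_closure (by simp))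
  have hy : y ∈ closure {x, y, g} ⊔ commutator G := mem_sup_left (subset_closure (by simp))
  refine eq_top_of_triple hgen hx hy (mem_of_zpow_mem_of_odd hz hk ?_)
  rw [show z ^ k = (y ^ j)⁻¹ * (x ^ i)⁻¹ * (g * c⁻¹) by rw [hg]; group]
  exact mul_mem (mul_mem (inv_mem (zpow_mem hy _)) (inv_mem (zpow_mem hx _)))
    (mul_mem (mem_sup_left (subset_closure (by simp))) (inv_mem (mem_sup_right hc)))

lemma exists_closure_triple_of_odd (hZ : commutator G ≤ center G) {x y z : G}
    (hgen : closure {x, y, z} = ⊤) {m : ℕ} (hm : ∀ g : G, g ^ 2 ^ m = 1) {i j k : ℤ}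
    (hodd : Odd i ∨ Odd j ∨ Odd k) {c g : G}
    (hc : c ∈ commutator G) (hg : g = x ^ i * y ^ j * z ^ k * c) :
    ∃ u v, closure {u, v, g} = ⊤ := by
  rcases hodd with h | h | h
  · have h1 := closure_exchange_left hZ hgen (hm x) h hc hg
    exact ⟨y, z, eq_top_of_triple h1 (subset_closure (by simp)) (subset_closure (by simp))
      (subset_closure (by simp))⟩
  · have h1 := closure_exchange_middle hZ hgen (hm y) h hc hg
    exact ⟨x, z, eq_top_of_triple h1 (subset_closure (by simp)) (subset_closure (by simp))
      (subset_closure (by simp))⟩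
  · exact ⟨x, y, closure_exchange_right hZ hgen (hm z) h hc hg⟩

end Exchange

/-! ### Consequences of criticality, and the case r ≥ 2. -/

/-- The properties of `2ℰ`-groups with `exp (G / G') = exp G' = 2 ^ r` that are used in their
classification. -/
structure IsCritical (G : Type*) [Group G] (r : ℕ) : Prop where
  commutator_le_center : commutator G ≤ center G
  pow_mem_commutator (g : G) : g ^ 2 ^ r ∈ commutator G
  mem_center_of_pow_eq_one (g : G) : g ^ 2 ^ r = 1 → g ∈ center G
  pow_eq_one_of_mem_commutator (c : G) : c ∈ commutator G → c ^ 2 ^ r = 1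

namespace IsCritical

variable {G : Type*} [Group G] {r : ℕ}

lemma pow_eq_one (h : IsCritical G r) (g : G) : g ^ 2 ^ (r + r) = 1 := by
  rw [pow_add, pow_mul]
  exact h.pow_eq_one_of_mem_commutator _ (h.pow_mem_commutator g)

/-- The quotient of the two elements is central and is killed by 2^r. -/
lemma pow_eq_pow_of_abelianization_eq (h : IsCritical G r) {a b : G}
    (hab : Abelianization.of a = Abelianization.of b) : a ^ 2 ^ r = b ^ 2 ^ r := by
  have hmem : a⁻¹ * b ∈ commutator G := by
    rw [← Abelianization.ker_of G, MonoidHom.mem_ker, map_mul, map_inv, hab, inv_mul_cancel]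
  have hcomm := (commute_of_mem_center (h.commutator_le_center hmem) a).symm
  rw [show b = a * (a⁻¹ * b) by group, hcomm.mul_pow, h.pow_eq_one_of_mem_commutator _ hmem,
    mul_one]

lemma commutatorElement_pow (h : IsCritical G r) (a b : G) : ⁅a, b⁆ ^ 2 ^ r = 1 :=
  h.pow_eq_one_of_mem_commutator _ (commutatorElement_mem_commutator a b)

/-- If equality held, g^N with N = 2^(r-1) would be central, so all [w,g]^N would vanish and N-th
powers in G' could only be 1 or s = [u,v]^N. It suffices to derive s = 1, which contradicts `hne`.
-/
lemma pow_pred_ne_one_of_triple (h : IsCritical G r) (hr : 2 ≤ r)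
    (hne : ∃ c ∈ commutator G, c ^ 2 ^ (r - 1) ≠ 1) {u v g : G} (hgen : closure {u, v, g} = ⊤) :
    (g ^ 2 ^ (r - 1)) ^ 2 ^ r ≠ 1 := by
  intro hg
  have hZ := h.commutator_le_center
  obtain ⟨m, rfl⟩ : ∃ m, r = m + 2 := ⟨r - 2, by omega⟩
  simp only [Nat.add_succ_sub_one] at *
  set N := 2 ^ (m + 1) with hN
  have hNn : 2 ^ (m + 2) = N * 2 := by rw [hN, ← pow_succ]
  have hgZ := h.mem_center_of_pow_eq_one _ hg
  have hug : ∀ w, ⁅w, g⁆ ^ N = 1 := fun w => by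
    rw [← commutatorElement_pow_right hZ, commutatorElement_of_mem_center_right hgZ]
  have hcommN : ∀ c ∈ commutator G, c ^ N = 1 ∨ c ^ N = ⁅u, v⁆ ^ N := by
    intro c hc
    obtain ⟨i, j, k, rfl⟩ := exists_zpow_commutatorElement hZ hgen hc
    have hcm : ∀ (a b : G) (i : ℤ) (w : G), Commute w (⁅a, b⁆ ^ i) := fun a b i w =>
      ((commute_commutatorElement hZ a b w).zpow_left i).symm
    have hs : (⁅u, v⁆ ^ N) ^ 2 = 1 := by rw [← pow_mul, ← hNn, h.commutatorElement_pow]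
    have hz : ∀ (a : G) (i : ℤ), (a ^ i) ^ N = (a ^ N) ^ i := fun a i => by
      rw [← zpow_natCast, ← zpow_natCast, zpow_comm]
    rw [(hcm v g k _).mul_pow, (hcm u g j _).mul_pow, hz, hz, hz, hug, hug, one_zpow, one_zpow,
      mul_one, mul_one]
    rcases Int.even_or_odd' i with ⟨l, rfl | rfl⟩
    · left; rw [zpow_mul]; norm_cast; rw [hs, one_zpow]
    · right; rw [zpow_add, zpow_mul]; norm_cast; rw [hs, one_zpow, one_mul, pow_one]
  have hswap : ∀ a : G, (a ^ N) ^ 2 ^ (m + 2) = (a ^ 2 ^ (m + 2)) ^ N := fun a => by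
    rw [← pow_mul, mul_comm, pow_mul]
  have hs : ⁅u, v⁆ ^ N = 1 := by
    -- If u^(2^r·N) = 1 then u^N is central and s = 1; likewise for v. If both powers equal s, their
    -- product is s² = 1 and uv takes over the role of u.
    rcases hcommN _ (h.pow_mem_commutator u) with hu | hu
    · rw [← commutatorElement_pow_left hZ]
      exact commutatorElement_of_mem_center_left
        (h.mem_center_of_pow_eq_one _ ((hswap u).trans hu)) _
    rcases hcommN _ (h.pow_mem_commutator v) with hv | hv
    · rw [← commutatorElement_pow_right hZ]
      exact commutatorElement_of_mem_center_right
        (h.mem_center_of_pow_eq_one _ ((hswap v).trans hv)) _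
    · have huv : ⁅u * v, v⁆ = ⁅u, v⁆ := by
        rw [commutatorElement_mul_left hZ, commutatorElement_self, mul_one]
      rw [← huv, ← commutatorElement_pow_left hZ]
      refine commutatorElement_of_mem_center_left (h.mem_center_of_pow_eq_one _ ?_) _
      -- The 2-part of the right side is 2^(2r-2), so this uses r ≥ 2. It removes the commutator
      -- term in (uv)^(2^r·N).
      have hdvd : 2 ^ (m + 2) ∣ (2 ^ (m + 2)).choose 2 * N := by
        rw [Nat.choose_two_right, hN, pow_succ 2 m, mul_comm (2 ^ m) 2, ← mul_assoc,
          Nat.div_mul_cancel (Nat.even_mul_pred_self _).two_dvd, mul_assoc]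
        exact dvd_mul_right _ _
      obtain ⟨l, hl⟩ := hdvd
      rw [hswap, mul_pow_of_class_two hZ, ((commute_commutatorElement hZ v u _).pow_left _).symm.mul_pow,
        (commute_of_mem_center (hZ (h.pow_mem_commutator u)) _).mul_pow, hu, hv, ← pow_mul, hl,
        pow_mul, h.commutatorElement_pow, one_pow, mul_one, ← pow_two, ← pow_mul, ← hNn,
        h.commutatorElement_pow]
  obtain ⟨c, hc, hc'⟩ := hne
  rcases hcommN c hc with h1 | h1
  · exact hc' h1
  · exact hc' (h1.trans hs)

lemma dvd_of_zpow_pow_eq_one (h : IsCritical G r) (hr : 2 ≤ r)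
    (hne : ∃ c ∈ commutator G, c ^ 2 ^ (r - 1) ≠ 1) {x y z : G} (hgen : closure {x, y, z} = ⊤)
    {i j k : ℤ} (hijk : (x ^ i * y ^ j * z ^ k) ^ 2 ^ r = 1) :
    ((2 ^ r : ℕ) : ℤ) ∣ i ∧ ((2 ^ r : ℕ) : ℤ) ∣ j ∧ ((2 ^ r : ℕ) : ℤ) ∣ k := by
  suffices H : ∀ m ≤ r, ((2 ^ m : ℕ) : ℤ) ∣ i ∧ ((2 ^ m : ℕ) : ℤ) ∣ j ∧ ((2 ^ m : ℕ) : ℤ) ∣ k from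
    H r le_rfl
  intro m
  induction m with
  | zero => simp
  | succ m ih =>
    intro hm
    obtain ⟨⟨i', rfl⟩, ⟨j', rfl⟩, ⟨k', rfl⟩⟩ := ih (by omega)
    -- Modulo G' the word is a 2^m-th power, and the 2^r-th power only sees it modulo G'. An odd
    -- exponent left after dividing by 2^m would make the base a member of a generating triple.
    have h1 : ((x ^ i' * y ^ j' * z ^ k') ^ 2 ^ m) ^ 2 ^ r = 1 := by
      rw [← hijk]
      refine h.pow_eq_pow_of_abelianization_eq ?_
      simp only [map_pow, map_mul, map_zpow, mul_pow, mul_comm _ i', mul_comm _ j', mul_comm _ k',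
        zpow_mul, zpow_natCast]
    have h2 : ((x ^ i' * y ^ j' * z ^ k') ^ 2 ^ (r - 1)) ^ 2 ^ r = 1 := by
      rw [show r - 1 = m + (r - 1 - m) by omega, pow_add, pow_mul, ← pow_mul _ _ (2 ^ r),
        mul_comm _ (2 ^ r), pow_mul, h1, one_pow]
    have h3 : ¬ (Odd i' ∨ Odd j' ∨ Odd k') := fun hodd => by
      obtain ⟨u, v, huv⟩ := exists_closure_triple_of_odd h.commutator_le_center hgen h.pow_eq_one
        hodd (one_mem _) (mul_one _).symm
      exact h.pow_pred_ne_one_of_triple hr hne huv h2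
    simp only [not_or, Int.not_odd_iff_even, even_iff_two_dvd] at h3
    rw [pow_succ]
    push_cast
    exact ⟨mul_dvd_mul_left _ h3.1, mul_dvd_mul_left _ h3.2.1, mul_dvd_mul_left _ h3.2.2⟩

/-- The obstruction to multiplicativity of the 2^r-th power is a commutator to the power C(2^r, 2),
which is only a multiple of 2^(r-1). The square supplies the missing factor 2. -/
lemma mul_sq_pow (h : IsCritical G r) (a b : G) :
    (a * b ^ 2) ^ 2 ^ r = a ^ 2 ^ r * (b ^ 2) ^ 2 ^ r := by
  rw [mul_pow_of_class_two h.commutator_le_center, commutatorElement_pow_left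
    h.commutator_le_center, ← pow_mul ⁅b, a⁆, Nat.choose_two_right,
    Nat.mul_div_cancel' (Nat.even_mul_pred_self _).two_dvd, pow_mul, h.commutatorElement_pow,
    one_pow, mul_one]

/-- The case `r ≥ 2` of the classification. -/
theorem exists_mulEquiv_groupG_of_two_le (h : IsCritical G r) (hr : 2 ≤ r)
    (hne : ∃ c ∈ commutator G, c ^ 2 ^ (r - 1) ≠ 1) {x y z : G} (hgen : closure {x, y, z} = ⊤) :
    ∃ T : GL (Fin 3) (ZMod (2 ^ r)), Nonempty (G ≃* GroupG 2 r r T) := by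
  have hZ := h.commutator_le_center
  have hdvd := fun {i j k} => h.dvd_of_zpow_pow_eq_one (i := i) (j := j) (k := k) hr hne hgen
  have heven : ∀ i j k : ℤ,
      (x ^ 2 ^ r) ^ (2 * i) * (y ^ 2 ^ r) ^ (2 * j) * (z ^ 2 ^ r) ^ (2 * k) = 1 →
      ((2 ^ r : ℕ) : ℤ) ∣ 2 * i ∧ ((2 ^ r : ℕ) : ℤ) ∣ 2 * j ∧ ((2 ^ r : ℕ) : ℤ) ∣ 2 * k := by
    intro i j k hijk
    refine hdvd ?_
    have hz : ∀ (a : G) (i : ℤ), (a ^ 2 ^ r) ^ i = (a ^ i) ^ 2 ^ r := fun a i => by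
      rw [← zpow_natCast, ← zpow_natCast, zpow_comm]
    have h2 : ∀ (a : G) (i : ℤ), a ^ (2 * i) = (a ^ i) ^ 2 := fun a i => by
      rw [mul_comm, zpow_mul]; norm_cast
    rw [← hijk, hz, hz, hz, h2 y, h2 z, h.mul_sq_pow, h.mul_sq_pow]
  have hindep : ∀ i j k : ℤ, (x ^ 2 ^ r) ^ i * (y ^ 2 ^ r) ^ j * (z ^ 2 ^ r) ^ k = 1 →
      ((2 ^ r : ℕ) : ℤ) ∣ i ∧ ((2 ^ r : ℕ) : ℤ) ∣ j ∧ ((2 ^ r : ℕ) : ℤ) ∣ k := by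
    intro i j k hijk
    have hcm : ∀ (a : G) (i : ℤ) (w : G), Commute w ((a ^ 2 ^ r) ^ i) := fun a i w =>
      ((commute_of_mem_center (hZ (h.pow_mem_commutator a)) w).zpow_left i).symm
    -- Squaring makes the exponents even, so `heven` gives 2^r ∣ 2i. As r ≥ 2, i itself is even, and
    -- `heven` applies to the original relation.
    have hsq := congrArg (· ^ 2) hijk
    simp only [one_pow] at hsq
    rw [(hcm z k _).mul_pow, (hcm y j _).mul_pow] at hsq
    simp only [← zpow_natCast _ 2, ← zpow_mul (_ ^ 2 ^ r), mul_comm _ ((2 : ℕ) : ℤ)] at hsq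
    have h4 : ∀ i : ℤ, ((2 ^ r : ℕ) : ℤ) ∣ 2 * i → ∃ l, i = 2 * l := by
      intro i hi
      obtain ⟨m, rfl⟩ : ∃ m, r = m + 2 := ⟨r - 2, by omega⟩
      obtain ⟨l, hl⟩ := hi
      refine ⟨(2 ^ m : ℕ) * l, ?_⟩
      rw [pow_add] at hl
      push_cast at hl ⊢
      linarith
    obtain ⟨h1, h2, h3⟩ := heven i j k hsq
    obtain ⟨i', rfl⟩ := h4 _ h1
    obtain ⟨j', rfl⟩ := h4 _ h2
    obtain ⟨k', rfl⟩ := h4 _ h3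
    exact heven _ _ _ hijk
  let : CommGroup (commutator G) := commutatorCommGroup hZ
  obtain ⟨hcard, hgenerates⟩ := card_eq_and_generates_of_independent (A := commutator G)
    (n := 2 ^ r) (fun a => Subtype.ext (h.pow_eq_one_of_mem_commutator a a.2))
    ![⟨x ^ 2 ^ r, h.pow_mem_commutator x⟩, ⟨y ^ 2 ^ r, h.pow_mem_commutator y⟩,
      ⟨z ^ 2 ^ r, h.pow_mem_commutator z⟩]
    ![⟨⁅x, y⁆, commutatorElement_mem_commutator x y⟩,
      ⟨⁅x, z⁆, commutatorElement_mem_commutator x z⟩,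
      ⟨⁅y, z⁆, commutatorElement_mem_commutator y z⟩]
    (fun i j k hijk => hindep i j k (congrArg Subtype.val hijk))
    (fun a => by
      obtain ⟨i, j, k, h⟩ := exists_zpow_commutatorElement hZ hgen a.2
      exact ⟨i, j, k, Subtype.ext h⟩)
  refine exists_mulEquiv_groupG hZ h.pow_eq_one_of_mem_commutator hgen (h.pow_mem_commutator x)
    (h.pow_mem_commutator y) (h.pow_mem_commutator z)
    (fun i j k hijk => hdvd (h.pow_eq_one_of_mem_commutator _ hijk)) hcard fun c hc => ?_
  obtain ⟨i, j, k, hijk⟩ := hgenerates ⟨c, hc⟩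
  have hc' : c = (x ^ 2 ^ r) ^ i * (y ^ 2 ^ r) ^ j * (z ^ 2 ^ r) ^ k := congrArg Subtype.val hijk
  rw [hc']
  exact mul_mem (mul_mem (zpow_mem (subset_closure (by simp)) _)
    (zpow_mem (subset_closure (by simp)) _)) (zpow_mem (subset_closure (by simp)) _)

end IsCritical

/-! ### The case r = 1: squares and commutators. -/

namespace IsCritical

variable {G : Type*} [Group G]

lemma sq_mem_commutator (h : IsCritical G 1) (g : G) : g ^ 2 ∈ commutator G :=
  h.pow_mem_commutator g

lemma sq_mem_center (h : IsCritical G 1) (g : G) : g ^ 2 ∈ center G :=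
  h.commutator_le_center (h.sq_mem_commutator g)

lemma mem_center_of_sq_eq_one (h : IsCritical G 1) {g : G} (hg : g ^ 2 = 1) : g ∈ center G :=
  h.mem_center_of_pow_eq_one g hg

lemma sq_eq_one_of_mem_commutator (h : IsCritical G 1) {c : G} (hc : c ∈ commutator G) :
    c ^ 2 = 1 :=
  h.pow_eq_one_of_mem_commutator c hc

lemma commutatorElement_sq (h : IsCritical G 1) (a b : G) : ⁅a, b⁆ ^ 2 = 1 :=
  h.commutatorElement_pow a b

lemma zpow_mem_commutator_of_even (h : IsCritical G 1) (g : G) {i : ℤ} (hi : Even i) :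
    g ^ i ∈ commutator G := by
  obtain ⟨k, rfl⟩ := even_iff_two_dvd.mp hi
  rw [zpow_mul]
  exact zpow_mem (by exact_mod_cast h.sq_mem_commutator g) k

lemma zpow_eq_one_of_even (h : IsCritical G 1) {c : G} (hc : c ∈ commutator G) {i : ℤ}
    (hi : Even i) : c ^ i = 1 := by
  obtain ⟨k, rfl⟩ := even_iff_two_dvd.mp hi
  rw [zpow_mul]
  norm_cast
  rw [h.sq_eq_one_of_mem_commutator hc, one_zpow]

lemma zpow_eq_self_of_odd (h : IsCritical G 1) {c : G} (hc : c ∈ commutator G) {i : ℤ}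
    (hi : Odd i) : c ^ i = c := by
  obtain ⟨k, rfl⟩ := hi
  rw [zpow_add, h.zpow_eq_one_of_even hc (even_two_mul k), zpow_one, one_mul]

lemma mul_sq_of_mem_commutator (h : IsCritical G 1) (g : G) {c : G} (hc : c ∈ commutator G) :
    (g * c) ^ 2 = g ^ 2 := by
  rw [(commute_of_mem_center (h.commutator_le_center hc) g).symm.mul_pow,
    h.sq_eq_one_of_mem_commutator hc, mul_one]

lemma mul_sq (h : IsCritical G 1) (a b : G) : (a * b) ^ 2 = a ^ 2 * b ^ 2 * ⁅a, b⁆ := by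
  rw [mul_pow_of_class_two h.commutator_le_center, Nat.choose_self, pow_one,
    ← commutatorElement_inv a b,
    inv_eq_of_mul_eq_one_right (by rw [← pow_two]; exact h.commutatorElement_sq a b)]

/-- An odd exponent would allow the corresponding generator to be exchanged for 1, leaving two
generators. -/
lemma even_of_mem_commutator (h : IsCritical G 1) (hrank : ∀ a b : G, closure {a, b} ≠ ⊤)
    {x y z : G} (hgen : closure {x, y, z} = ⊤) {i j k : ℤ}
    (hijk : x ^ i * y ^ j * z ^ k ∈ commutator G) : Even i ∧ Even j ∧ Even k := by
  have hZ := h.commutator_le_center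
  have h1 : 1 = x ^ i * y ^ j * z ^ k * (x ^ i * y ^ j * z ^ k)⁻¹ := by group
  have hpair : ∀ {a b c d e : G}, closure {a, b, c} = ⊤ → a ∈ closure {d, e} → b ∈ closure {d, e} →
      c ∈ closure {d, e} → False := fun habc ha hb hc =>
    hrank _ _ (eq_top_of_triple habc ha hb hc)
  refine ⟨?_, ?_, ?_⟩ <;> rw [← Int.not_odd_iff_even] <;> intro hodd
  · exact hpair (closure_exchange_left hZ hgen (h.pow_eq_one x) hodd (inv_mem hijk) h1)
      (one_mem _) (subset_closure (.inl rfl)) (subset_closure (.inr rfl))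
  · exact hpair (closure_exchange_middle hZ hgen (h.pow_eq_one y) hodd (inv_mem hijk) h1)
      (subset_closure (.inl rfl)) (one_mem _) (subset_closure (.inr rfl))
  · exact hpair (closure_exchange_right hZ hgen (h.pow_eq_one z) hodd (inv_mem hijk) h1)
      (subset_closure (.inl rfl)) (subset_closure (.inr rfl)) (one_mem _)

/-! ### The case r = 1 with derived subgroup of order eight. -/

section RankThree

lemma even_of_card_eq (h : IsCritical G 1) (hcard : Nat.card (commutator G) = 2 ^ 3) {a b c : G}
    (ha : a ∈ commutator G) (hb : b ∈ commutator G) (hc : c ∈ commutator G)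
    (hle : commutator G ≤ closure {a, b, c}) {i j k : ℤ} (hijk : a ^ i * b ^ j * c ^ k = 1) :
    Even i ∧ Even j ∧ Even k := by
  have hZ := h.commutator_le_center
  let : CommGroup (commutator G) := commutatorCommGroup hZ
  have hgen : ∀ d : commutator G, ∃ i j k : ℤ,
      d = ![⟨a, ha⟩, ⟨b, hb⟩, ⟨c, hc⟩] 0 ^ i * ![⟨a, ha⟩, ⟨b, hb⟩, ⟨c, hc⟩] 1 ^ j *
        ![⟨a, ha⟩, ⟨b, hb⟩, ⟨c, hc⟩] 2 ^ k := fun d => by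
    obtain ⟨i, j, k, hd⟩ := exists_zpow_of_mem_closure_triple (hZ ha) (hZ hb) (hZ hc) (hle d.2)
    exact ⟨i, j, k, Subtype.ext hd⟩
  have := (exists_GL_of_generating_triples (A := commutator G) (n := 2)
    (fun d => Subtype.ext (h.sq_eq_one_of_mem_commutator d.2)) hcard _ _ hgen hgen).2 i j k
    (Subtype.ext hijk)
  simpa only [even_iff_two_dvd, Nat.cast_ofNat] using this

lemma le_closure_of_even (h : IsCritical G 1) {x y z : G} (hgen : closure {x, y, z} = ⊤)
    {a b c : G} (ha : a ∈ commutator G) (hb : b ∈ commutator G) (hc : c ∈ commutator G)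
    (hind : ∀ i j k : ℤ, a ^ i * b ^ j * c ^ k = 1 → Even i ∧ Even j ∧ Even k) :
    Nat.card (commutator G) = 2 ^ 3 ∧ commutator G ≤ closure {a, b, c} := by
  have hZ := h.commutator_le_center
  let : CommGroup (commutator G) := commutatorCommGroup hZ
  obtain ⟨hcard, hgenerates⟩ := card_eq_and_generates_of_independent (A := commutator G)
    (n := 2) (fun a => Subtype.ext (h.sq_eq_one_of_mem_commutator a.2))
    ![⟨a, ha⟩, ⟨b, hb⟩, ⟨c, hc⟩]
    ![⟨⁅x, y⁆, commutatorElement_mem_commutator x y⟩,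
      ⟨⁅x, z⁆, commutatorElement_mem_commutator x z⟩,
      ⟨⁅y, z⁆, commutatorElement_mem_commutator y z⟩]
    (fun i j k hijk => by
      simpa only [even_iff_two_dvd, Nat.cast_ofNat] using hind i j k (congrArg Subtype.val hijk))
    (fun a => by
      obtain ⟨i, j, k, h⟩ := exists_zpow_commutatorElement hZ hgen a.2
      exact ⟨i, j, k, Subtype.ext h⟩)
  refine ⟨hcard, fun d hd => ?_⟩
  obtain ⟨i, j, k, hijk⟩ := hgenerates ⟨d, hd⟩
  have hd' : d = a ^ i * b ^ j * c ^ k := congrArg Subtype.val hijk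
  rw [hd']
  exact mul_mem (mul_mem (zpow_mem (subset_closure (by simp)) _)
    (zpow_mem (subset_closure (by simp)) _)) (zpow_mem (subset_closure (by simp)) _)

/-- By polarization, [a,b] = (a²b²)⁻¹(ab)². -/
lemma commutator_le_of_sq_mem (h : IsCritical G 1) {N : Subgroup G} (hN : ∀ g : G, g ^ 2 ∈ N) :
    commutator G ≤ N := by
  rw [_root_.commutator_def, commutator_le]
  intro a _ b _
  have := mul_mem (inv_mem (mul_mem (hN a) (hN b))) (hN (a * b))
  rwa [h.mul_sq, inv_mul_cancel_left] at this

/-- If the derived subgroup has order eight, it is generated by the squares of suitable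
generators. -/
lemma exists_triple_sq_generates (h : IsCritical G 1) {x y z : G}
    (hgen : closure {x, y, z} = ⊤) (hcard : Nat.card (commutator G) = 2 ^ 3) :
    ∃ u v w : G, closure {u, v, w} = ⊤ ∧ commutator G ≤ closure {u ^ 2, v ^ 2, w ^ 2} := by
  have hZ := h.commutator_le_center
  -- Two elements cannot generate G': padded by 1 they would form a basis, in which the relation
  -- with exponents (0,0,1) is impossible.
  have hsmall : ∀ {N : Subgroup G} {a b : G}, a ∈ commutator G → b ∈ commutator G →
      N ≤ closure {a, b, 1} → ¬ commutator G ≤ N := by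
    intro N a b ha hb hN hle
    have := (h.even_of_card_eq hcard ha hb (one_mem _) (hle.trans hN) (i := 0) (j := 0) (k := 1)
      (by simp)).2.2
    simp at this
  have hx : x ^ 2 ≠ 1 := by
    intro hx
    have hxc := h.mem_center_of_sq_eq_one hx
    have hle : commutator G ≤ closure {⁅y, z⁆, 1, 1} := by
      refine commutator_le_of_triple hgen ?_ ?_ ?_ (subset_closure (by simp))
      · rw [closure_le]
        rintro g (rfl | rfl | rfl)
        exacts [hZ (commutatorElement_mem_commutator _ _), one_mem _, one_mem _]
      · rw [commutatorElement_of_mem_center_left hxc]; exact one_mem _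
      · rw [commutatorElement_of_mem_center_left hxc]; exact one_mem _
    exact hsmall (commutatorElement_mem_commutator y z) (one_mem _) le_rfl hle
  obtain ⟨v, hv⟩ : ∃ v : G, v ^ 2 ∉ closure {x ^ 2} := by
    by_contra! hall
    refine hsmall (h.sq_mem_commutator x) (one_mem _) ?_ (h.commutator_le_of_sq_mem hall)
    rw [closure_le]
    rintro g rfl
    exact subset_closure (by simp)
  obtain ⟨w, hw⟩ : ∃ w : G, w ^ 2 ∉ closure {x ^ 2, v ^ 2} := by
    by_contra! hall
    refine hsmall (h.sq_mem_commutator x) (h.sq_mem_commutator v) ?_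
      (h.commutator_le_of_sq_mem hall)
    rw [closure_le]
    rintro g (rfl | rfl) <;> exact subset_closure (by simp)
  have hodd : ∀ {c : G} {i : ℤ} {N : Subgroup G}, c ∈ commutator G → c ^ i ∈ N → c ∉ N → Even i := by
    intro c i N hc hi hcN
    rw [← Int.not_odd_iff_even]
    intro ho
    rw [h.zpow_eq_self_of_odd hc ho] at hi
    exact hcN hi
  have hgen2 : commutator G ≤ closure {x ^ 2, v ^ 2, w ^ 2} := by
    refine (h.le_closure_of_even hgen (h.sq_mem_commutator x) (h.sq_mem_commutator v)
      (h.sq_mem_commutator w) fun i j k hijk => ?_).2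
    have hk : Even k := by
      refine hodd (h.sq_mem_commutator w) ?_ hw
      rw [← inv_eq_of_mul_eq_one_right hijk]
      exact inv_mem (mul_mem (zpow_mem (subset_closure (by simp)) _)
        (zpow_mem (subset_closure (by simp)) _))
    rw [h.zpow_eq_one_of_even (h.sq_mem_commutator w) hk, mul_one] at hijk
    have hj : Even j := by
      refine hodd (h.sq_mem_commutator v) ?_ hv
      rw [← inv_eq_of_mul_eq_one_right hijk]
      exact inv_mem (zpow_mem (subset_closure (by simp)) _)
    rw [h.zpow_eq_one_of_even (h.sq_mem_commutator v) hj, mul_one] at hijk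
    exact ⟨hodd (N := ⊥) (h.sq_mem_commutator x) (by simp [hijk]) (by simpa using hx), hj, hk⟩
  have hsqz : ∀ (g : G) (i : ℤ), (g ^ i) ^ 2 = (g ^ 2) ^ i := fun g i => by
    rw [← zpow_natCast, ← zpow_natCast, zpow_comm]
  -- Since v² is not a power of x², v is not a power of x modulo G', so x, v extend to a generating
  -- triple.
  obtain ⟨t, ht⟩ : ∃ t, closure {x, v, t} = ⊤ := by
    obtain ⟨i, j, k, c, hc, hvc⟩ := exists_zpow_mul_mem_commutator hgen v
    rcases Int.even_or_odd k with hk | hk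
    · rcases Int.even_or_odd j with hj | hj
      · refine absurd ?_ hv
        rw [hvc, h.mul_sq_of_mem_commutator _ hc,
          h.mul_sq_of_mem_commutator _ (h.zpow_mem_commutator_of_even z hk),
          h.mul_sq_of_mem_commutator _ (h.zpow_mem_commutator_of_even y hj), hsqz]
        exact zpow_mem (subset_closure (by simp)) _
      · exact ⟨z, closure_exchange_middle hZ hgen (h.pow_eq_one y) hj hc hvc⟩
    · refine ⟨y, ?_⟩
      rw [Set.pair_comm]
      exact closure_exchange_right hZ hgen (h.pow_eq_one z) hk hc hvc
  obtain ⟨i, j, k, c, hc, hwc⟩ := exists_zpow_mul_mem_commutator ht w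
  rcases Int.even_or_odd k with hk | hk
  swap
  · exact ⟨x, v, w, closure_exchange_right hZ ht (h.pow_eq_one t) hk hc hwc, hgen2⟩
  have hw2 : w ^ 2 = (x ^ i * v ^ j) ^ 2 := by
    rw [hwc, h.mul_sq_of_mem_commutator _ hc,
      h.mul_sq_of_mem_commutator _ (h.zpow_mem_commutator_of_even t hk)]
  have hoddsplit : ∀ (g : G) {i : ℤ}, Odd i → ∃ c ∈ commutator G, g ^ i = g * c := by
    rintro g i ⟨l, rfl⟩
    exact ⟨g ^ (2 * l), h.zpow_mem_commutator_of_even g (even_two_mul l), by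
      rw [add_comm, zpow_add, zpow_one]⟩
  -- Now w lies in ⟨x, v⟩ modulo G'. Its square excludes every class except that of xv.
  have hwxv : w ^ 2 = (x * v) ^ 2 := by
    rcases Int.even_or_odd j with hj | hj
    · refine absurd ?_ hw
      rw [hw2, h.mul_sq_of_mem_commutator _ (h.zpow_mem_commutator_of_even v hj), hsqz]
      exact zpow_mem (subset_closure (by simp)) _
    rcases Int.even_or_odd i with hi | hi
    · refine absurd ?_ hw
      have hxi := h.zpow_mem_commutator_of_even x hi
      rw [hw2, (commute_of_mem_center (hZ hxi) _).eq, h.mul_sq_of_mem_commutator _ hxi, hsqz]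
      exact zpow_mem (subset_closure (by simp)) _
    · obtain ⟨c, hc, hcx⟩ := hoddsplit x hi
      obtain ⟨d, hd, hdv⟩ := hoddsplit v hj
      rw [hw2, hcx, hdv, mul_assoc, (commute_of_mem_center (hZ hc) _).eq, ← mul_assoc, ← mul_assoc,
        h.mul_sq_of_mem_commutator _ hc, h.mul_sq_of_mem_commutator _ hd]
  rw [hwxv] at hgen2
  have ht2 : t ^ 2 ≠ 1 := by
    intro ht1
    have htc := h.mem_center_of_sq_eq_one ht1
    have hle : commutator G ≤ closure {⁅x, v⁆, 1, 1} := by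
      refine commutator_le_of_triple ht ?_ (subset_closure (by simp)) ?_ ?_
      · rw [closure_le]
        rintro g (rfl | rfl | rfl)
        exacts [hZ (commutatorElement_mem_commutator _ _), one_mem _, one_mem _]
      · rw [commutatorElement_of_mem_center_right htc]; exact one_mem _
      · rw [commutatorElement_of_mem_center_right htc]; exact one_mem _
    exact hsmall (commutatorElement_mem_commutator x v) (one_mem _) le_rfl hle
  -- As t² ≠ 1, it can replace one of the basis elements x², v², (xv)². Any two of x, v, xv together
  -- with t still generate G.
  obtain ⟨a, b, d, habd⟩ := exists_zpow_of_mem_closure_triple (h.sq_mem_center x)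
    (h.sq_mem_center v) (h.sq_mem_center (x * v)) (hgen2 (h.sq_mem_commutator t))
  have hle3 : ∀ {N : Subgroup G}, x ^ 2 ∈ N → v ^ 2 ∈ N → (x * v) ^ 2 ∈ N → commutator G ≤ N := by
    intro N h1 h2 h3
    refine hgen2.trans ?_
    rw [closure_le]
    rintro g (rfl | rfl | rfl)
    exacts [h1, h2, h3]
  rcases Int.even_or_odd a with ha | ha
  swap
  · refine ⟨t, v, x * v, eq_top_of_triple ht ?_ (subset_closure (by simp))
      (subset_closure (by simp)), hle3 ?_ (subset_closure (by simp)) (subset_closure (by simp))⟩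
    · rw [show x = x * v * v⁻¹ by group]
      exact mul_mem (subset_closure (by simp)) (inv_mem (subset_closure (by simp)))
    · rw [h.zpow_eq_self_of_odd (h.sq_mem_commutator x) ha] at habd
      rw [show x ^ 2 = t ^ 2 * (((x * v) ^ 2) ^ d)⁻¹ * ((v ^ 2) ^ b)⁻¹ by rw [habd]; group]
      exact mul_mem (mul_mem (subset_closure (by simp))
        (inv_mem (zpow_mem (subset_closure (by simp)) _)))
        (inv_mem (zpow_mem (subset_closure (by simp)) _))
  rw [h.zpow_eq_one_of_even (h.sq_mem_commutator x) ha, one_mul] at habd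
  rcases Int.even_or_odd b with hb | hb
  swap
  · refine ⟨x, t, x * v, eq_top_of_triple ht (subset_closure (by simp)) ?_
      (subset_closure (by simp)), hle3 (subset_closure (by simp)) ?_ (subset_closure (by simp))⟩
    · rw [show v = x⁻¹ * (x * v) by group]
      exact mul_mem (inv_mem (subset_closure (by simp))) (subset_closure (by simp))
    · rw [h.zpow_eq_self_of_odd (h.sq_mem_commutator v) hb] at habd
      rw [show v ^ 2 = t ^ 2 * (((x * v) ^ 2) ^ d)⁻¹ by rw [habd]; group]
      exact mul_mem (subset_closure (by simp)) (inv_mem (zpow_mem (subset_closure (by simp)) _))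
  rw [h.zpow_eq_one_of_even (h.sq_mem_commutator v) hb, one_mul] at habd
  rcases Int.even_or_odd d with hd | hd
  · exact absurd (habd.trans (h.zpow_eq_one_of_even (h.sq_mem_commutator _) hd)) ht2
  · rw [h.zpow_eq_self_of_odd (h.sq_mem_commutator _) hd] at habd
    refine ⟨x, v, t, ht, hle3 (subset_closure (by simp)) (subset_closure (by simp)) ?_⟩
    rw [← habd]
    exact subset_closure (by simp)

theorem exists_mulEquiv_groupG_of_card (h : IsCritical G 1)
    (hrank : ∀ a b : G, closure {a, b} ≠ ⊤) {x y z : G}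
    (hgen : closure {x, y, z} = ⊤) (hcard : Nat.card (commutator G) = 2 ^ 3) :
    ∃ T : GL (Fin 3) (ZMod (2 ^ 1)), Nonempty (G ≃* GroupG 2 1 1 T) := by
  obtain ⟨u, v, w, huvw, hle⟩ := h.exists_triple_sq_generates hgen hcard
  refine exists_mulEquiv_groupG h.commutator_le_center h.pow_eq_one_of_mem_commutator huvw
    (h.pow_mem_commutator u) (h.pow_mem_commutator v) (h.pow_mem_commutator w)
    (fun i j k hijk => ?_) hcard hle
  simpa only [even_iff_two_dvd, pow_one, Nat.cast_ofNat] using h.even_of_mem_commutator hrank huvw hijk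

end RankThree

end IsCritical

/-! ### Normal forms forced by the relations of the two exceptional groups. -/

section Relations

variable {G : Type*} [Group G]

/-- The relators of `GroupA`. -/
def groupARels : Set (FreeGroup (Fin 3)) :=
  {x ^ 4, y ^ 4, commElt y z, x ^ 2 * (z ^ 2)⁻¹, z ^ 2 * (commElt x y)⁻¹,
    (x * z) ^ 2 * (y ^ 2)⁻¹}

/-- The relators of `GroupB`. -/
def groupBRels : Set (FreeGroup (Fin 3)) :=
  {x ^ 4, z ^ 4, commElt y z, x ^ 2 * (y ^ 2)⁻¹, y ^ 2 * (commElt x y)⁻¹,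
    commElt x z * (z ^ 2)⁻¹}

lemma forall_groupARels_iff (a b c : G) :
    (∀ w ∈ groupARels, FreeGroup.lift ![a, b, c] w = 1) ↔
      a ^ 4 = 1 ∧ b ^ 4 = 1 ∧ Commute b c ∧ a ^ 2 = c ^ 2 ∧ c ^ 2 = commElt a b ∧
      (a * c) ^ 2 = b ^ 2 := by
  simp only [groupARels, Set.mem_insert_iff, Set.mem_singleton_iff, forall_eq_or_imp, forall_eq,
    map_pow, map_mul, map_inv, map_commElt, mul_inv_eq_one, commElt_eq_one_iff,
    PEGroups.x, PEGroups.y, PEGroups.z, FreeGroup.lift_apply_of, Matrix.cons_val]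

lemma forall_groupBRels_iff (a b c : G) :
    (∀ w ∈ groupBRels, FreeGroup.lift ![a, b, c] w = 1) ↔
      a ^ 4 = 1 ∧ c ^ 4 = 1 ∧ Commute b c ∧ a ^ 2 = b ^ 2 ∧ b ^ 2 = commElt a b ∧
      commElt a c = c ^ 2 := by
  simp only [groupBRels, Set.mem_insert_iff, Set.mem_singleton_iff, forall_eq_or_imp, forall_eq,
    map_pow, map_mul, map_inv, map_commElt, mul_inv_eq_one, commElt_eq_one_iff,
    PEGroups.x, PEGroups.y, PEGroups.z, FreeGroup.lift_apply_of, Matrix.cons_val]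

lemma normal_form_of_groupARels {a b c : G} (hgen : closure {a, b, c} = ⊤)
    (hrel : ∀ w ∈ groupARels, FreeGroup.lift ![a, b, c] w = 1) (g : G) :
    ∃ i j k : ℤ, g = a ^ i * b ^ j * c ^ k := by
  obtain ⟨ha4, hb4, hbc, hac, hcab, hacb⟩ := (forall_groupARels_iff _ _ _).mp hrel
  have haZ : a ^ 2 ∈ center G := mem_center_of_triple hgen ((Commute.refl a).pow_left 2)
    (hac ▸ (hbc.symm.pow_left 2)) (hac ▸ (Commute.refl c).pow_left 2)
  have hcZ : c ^ 2 ∈ center G := hac ▸ haZ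
  have hbZ : b ^ 2 ∈ center G := by
    refine mem_center_of_triple hgen ?_ ((Commute.refl b).pow_left 2) (hbc.pow_left 2)
    -- The relation (ac)² = b² makes b² commute with ac; it also commutes with c, hence with a.
    have h1 : Commute (b ^ 2) (a * c) := hacb ▸ (Commute.refl (a * c)).pow_left 2
    rw [show a = a * c * c⁻¹ by group]
    exact h1.mul_right (hbc.pow_left 2).inv_right
  have hle : closure {a ^ 2, b ^ 2, c ^ 2} ≤ center G := by
    rw [closure_le]; rintro g (rfl | rfl | rfl) <;> assumption
  refine exists_zpow_of_pow_mem_center hgen haZ hbZ hcZ ?_ ?_ ?_ g <;>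
    rw [← commElt_mem_iff hle]
  · rw [← hcab]; exact subset_closure (by simp)
  · have h2 : commElt a c = (a ^ 2)⁻¹ * (c ^ 2)⁻¹ * b ^ 2 := by
      rw [← hacb, commElt, pow_two (a * c)]
      calc a⁻¹ * c⁻¹ * a * c = (a ^ 2)⁻¹ * (a * (c ^ 2)⁻¹) * (c * a * c) := by group
        _ = (a ^ 2)⁻¹ * ((c ^ 2)⁻¹ * a) * (c * a * c) := by
          rw [(commute_of_mem_center (inv_mem hcZ) a).eq]
        _ = (a ^ 2)⁻¹ * (c ^ 2)⁻¹ * (a * c * (a * c)) := by group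
    rw [h2]
    exact mul_mem (mul_mem (inv_mem (subset_closure (by simp)))
      (inv_mem (subset_closure (by simp)))) (subset_closure (by simp))
  · rw [(commElt_eq_one_iff _ _).mpr hbc]; exact one_mem _

lemma normal_form_of_groupBRels {a b c : G} (hgen : closure {a, b, c} = ⊤)
    (hrel : ∀ w ∈ groupBRels, FreeGroup.lift ![a, b, c] w = 1) (g : G) :
    ∃ i j k : ℤ, g = a ^ i * b ^ j * c ^ k := by
  obtain ⟨ha4, hc4, hbc, hab, hbab, hacc⟩ := (forall_groupBRels_iff _ _ _).mp hrel
  have haZ : a ^ 2 ∈ center G := mem_center_of_triple hgen ((Commute.refl a).pow_left 2)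
    (hab ▸ (Commute.refl b).pow_left 2) (hab ▸ hbc.pow_left 2)
  have hbZ : b ^ 2 ∈ center G := hab ▸ haZ
  have hcZ : c ^ 2 ∈ center G := by
    refine mem_center_of_triple hgen ?_ (hbc.symm.pow_left 2) ((Commute.refl c).pow_left 2)
    -- The relation [a,c] = c² says that a inverts c; hence a fixes c², because c⁴ = 1.
    have h1 : a⁻¹ * c * a = c⁻¹ := by
      have h2 : a⁻¹ * c⁻¹ * a = c := by
        rw [commElt, pow_two] at hacc
        exact mul_right_cancel hacc
      calc a⁻¹ * c * a = (a⁻¹ * c⁻¹ * a)⁻¹ := by group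
        _ = c⁻¹ := by rw [h2]
    have h2 : a⁻¹ * c ^ 2 * a = c ^ 2 := by
      calc a⁻¹ * c ^ 2 * a = (a⁻¹ * c * a) ^ 2 := by rw [pow_two, pow_two]; group
        _ = (c ^ 4)⁻¹ * c ^ 2 := by rw [h1]; group
        _ = c ^ 2 := by rw [hc4]; group
    rw [commute_iff_eq]
    conv_rhs => rw [← h2]
    group
  have hle : closure {a ^ 2, b ^ 2, c ^ 2} ≤ center G := by
    rw [closure_le]; rintro g (rfl | rfl | rfl) <;> assumption
  refine exists_zpow_of_pow_mem_center hgen haZ hbZ hcZ ?_ ?_ ?_ g <;>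
    rw [← commElt_mem_iff hle]
  · rw [← hbab]; exact subset_closure (by simp)
  · rw [hacc]; exact subset_closure (by simp)
  · rw [(commElt_eq_one_iff _ _).mpr hbc]; exact one_mem _

end Relations

/-! ### The case r = 1 with dependent commutators. -/

namespace IsCritical

variable {G : Type*} [Group G]

lemma zpow_two_mul_eq (g : G) (i : ℤ) : g ^ (2 * i) = (g ^ 2) ^ i := by
  rw [zpow_mul]; norm_cast

lemma pow_four_eq_one (h : IsCritical G 1) (g : G) : g ^ 4 = 1 := h.pow_eq_one g

/-- If the centre is contained in the derived subgroup, commutators with `x` are independent. -/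
lemma even_of_commutatorElement_eq_one (h : IsCritical G 1)
    (hrank : ∀ a b : G, closure {a, b} ≠ ⊤) (hcen : center G ≤ commutator G) {x y z : G}
    (hgen : closure {x, y, z} = ⊤) (hyz : Commute y z) {i j : ℤ}
    (hij : ⁅x, y⁆ ^ i * ⁅x, z⁆ ^ j = 1) : Even i ∧ Even j := by
  have hZ := h.commutator_le_center
  rw [← commutatorElement_zpow_right hZ, ← commutatorElement_zpow_right hZ,
    ← commutatorElement_mul_right hZ, commutatorElement_eq_one_iff_commute] at hij
  have hmem : y ^ i * z ^ j ∈ center G := mem_center_of_triple hgen hij.symm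
    (((Commute.refl y).zpow_left i).mul_left (hyz.symm.zpow_left j))
    ((hyz.zpow_left i).mul_left ((Commute.refl z).zpow_left j))
  exact (h.even_of_mem_commutator hrank hgen (i := 0) (by simpa using hcen hmem)).2

theorem nonempty_mulEquiv_groupA (h : IsCritical G 1) (hrank : ∀ a b : G, closure {a, b} ≠ ⊤)
    (hcen : center G ≤ commutator G) {x y z : G} (hgen : closure {x, y, z} = ⊤)
    (hyz : Commute y z) (hxz : x ^ 2 = z ^ 2) (hz : z ^ 2 = ⁅x, y⁆) (hy : y ^ 2 = ⁅x, z⁆) :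
    Nonempty (G ≃* GroupA) := by
  have hZ := h.commutator_le_center
  refine nonempty_mulEquiv_presentedGroup (rels := groupARels) hgen
    ((forall_groupARels_iff _ _ _).mpr ⟨h.pow_four_eq_one x, h.pow_four_eq_one y, hyz, hxz,
      by rw [hz, commElt_eq_commutatorElement hZ], ?_⟩)
    fun {H} _ X Y Z hgenH hrel => ⟨normal_form_of_groupARels hgenH hrel, fun i j k hijk => ?_⟩
  -- (xz)² = x²z²[x,z] = z⁴[x,z], so this relator encodes y² = [x,z].
  · rw [h.mul_sq, hxz, ← pow_two, ← pow_mul, h.pow_four_eq_one, one_mul, hy]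
  · obtain ⟨hX, hY, -, hXZ, -, -⟩ := (forall_groupARels_iff _ _ _).mp hrel
    obtain ⟨hi, hj, hk⟩ := h.even_of_mem_commutator hrank hgen (hijk ▸ one_mem _)
    rw [even_iff_two_dvd] at hi hj hk
    obtain ⟨i, rfl⟩ := hi
    obtain ⟨j, rfl⟩ := hj
    obtain ⟨k, rfl⟩ := hk
    simp only [zpow_two_mul_eq] at hijk ⊢
    rw [hxz, hz, hy, mul_assoc, ((commute_commutatorElement hZ x z _).zpow_left j).eq, ← mul_assoc,
      ← zpow_add] at hijk
    obtain ⟨hik, hj⟩ := h.even_of_commutatorElement_eq_one hrank hcen hgen hyz hijk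
    obtain ⟨l, hl⟩ := even_iff_two_dvd.mp hik
    obtain ⟨m, rfl⟩ := even_iff_two_dvd.mp hj
    have hY2 : (Y ^ 2) ^ (2 * m) = 1 := by rw [zpow_two_mul_eq, ← pow_mul, hY, one_zpow]
    rw [hY2, mul_one, ← hXZ, ← zpow_add, hl, zpow_two_mul_eq, ← pow_mul, hX, one_zpow]

theorem nonempty_mulEquiv_groupB (h : IsCritical G 1) (hrank : ∀ a b : G, closure {a, b} ≠ ⊤)
    (hcen : center G ≤ commutator G) {x y z : G} (hgen : closure {x, y, z} = ⊤)
    (hyz : Commute y z) (hxy : x ^ 2 = y ^ 2) (hy : y ^ 2 = ⁅x, y⁆) (hz : z ^ 2 = ⁅x, z⁆) :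
    Nonempty (G ≃* GroupB) := by
  have hZ := h.commutator_le_center
  refine nonempty_mulEquiv_presentedGroup (rels := groupBRels) hgen
    ((forall_groupBRels_iff _ _ _).mpr ⟨h.pow_four_eq_one x, h.pow_four_eq_one z, hyz, hxy,
      by rw [hy, commElt_eq_commutatorElement hZ], by rw [hz, commElt_eq_commutatorElement hZ]⟩)
    fun {H} _ X Y Z hgenH hrel => ⟨normal_form_of_groupBRels hgenH hrel, fun i j k hijk => ?_⟩
  obtain ⟨hX, hZ4, -, hXY, -, -⟩ := (forall_groupBRels_iff _ _ _).mp hrel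
  obtain ⟨hi, hj, hk⟩ := h.even_of_mem_commutator hrank hgen (hijk ▸ one_mem _)
  rw [even_iff_two_dvd] at hi hj hk
  obtain ⟨i, rfl⟩ := hi
  obtain ⟨j, rfl⟩ := hj
  obtain ⟨k, rfl⟩ := hk
  simp only [zpow_two_mul_eq] at hijk ⊢
  rw [hxy, hz, hy, ← zpow_add] at hijk
  obtain ⟨hij, hk⟩ := h.even_of_commutatorElement_eq_one hrank hcen hgen hyz hijk
  obtain ⟨l, hl⟩ := even_iff_two_dvd.mp hij
  obtain ⟨m, rfl⟩ := even_iff_two_dvd.mp hk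
  have hZ2 : (Z ^ 2) ^ (2 * m) = 1 := by rw [zpow_two_mul_eq, ← pow_mul, hZ4, one_zpow]
  rw [hZ2, mul_one, ← hXY, ← zpow_add, hl, zpow_two_mul_eq, ← pow_mul, hX, one_zpow]

/-- If the commutators of the generators are dependent, then suitable generators `y`, `z`
commute. -/
lemma exists_triple_commute (h : IsCritical G 1) {x y z : G} (hgen : closure {x, y, z} = ⊤)
    {i j k : ℤ} (hijk : ⁅x, y⁆ ^ i * ⁅x, z⁆ ^ j * ⁅y, z⁆ ^ k = 1)
    (hodd : ¬ (Even i ∧ Even j ∧ Even k)) :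
    ∃ u v w : G, closure {u, v, w} = ⊤ ∧ Commute v w := by
  have hZ := h.commutator_le_center
  have hcm := commutatorElement_mem_commutator (G := G)
  have hcz : ∀ (a b : G) (i : ℤ) (g : G), ⁅a, b⁆ ^ i * g = g * ⁅a, b⁆ ^ i := fun a b i g =>
    ((commute_commutatorElement hZ a b g).zpow_left i).eq
  rcases Int.even_or_odd k with hk | hk
  · rw [h.zpow_eq_one_of_even (hcm y z) hk, mul_one] at hijk
    rcases Int.even_or_odd j with hj | hj
    · rw [h.zpow_eq_one_of_even (hcm x z) hj, mul_one] at hijk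
      rcases Int.even_or_odd i with hi | hi
      · exact absurd ⟨hi, hj, hk⟩ hodd
      · rw [h.zpow_eq_self_of_odd (hcm x y) hi, commutatorElement_eq_one_iff_commute] at hijk
        exact ⟨z, x, y, eq_top_of_triple hgen (subset_closure (by simp))
          (subset_closure (by simp)) (subset_closure (by simp)), hijk⟩
    · rw [h.zpow_eq_self_of_odd (hcm x z) hj, ← commutatorElement_zpow_right hZ,
        ← commutatorElement_mul_right hZ, commutatorElement_eq_one_iff_commute] at hijk
      refine ⟨y, x, y ^ i * z, eq_top_of_triple hgen (subset_closure (by simp))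
          (subset_closure (by simp)) ?_, hijk⟩
      rw [show z = (y ^ i)⁻¹ * (y ^ i * z) by group]
      exact mul_mem (inv_mem (zpow_mem (subset_closure (by simp)) _)) (subset_closure (by simp))
  · rw [h.zpow_eq_self_of_odd (hcm y z) hk] at hijk
    -- By bilinearity [y x^j, z x^(-i)] = [y,z][x,y]^i[x,z]^j, the given relation. In other words,
    -- every bivector in dimension three is decomposable.
    refine ⟨x, y * x ^ j, z * x ^ (-i), eq_top_of_triple hgen (subset_closure (by simp)) ?_ ?_, ?_⟩
    · rw [show y = y * x ^ j * (x ^ j)⁻¹ by group]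
      exact mul_mem (subset_closure (by simp)) (inv_mem (zpow_mem (subset_closure (by simp)) _))
    · rw [show z = z * x ^ (-i) * (x ^ (-i))⁻¹ by group]
      exact mul_mem (subset_closure (by simp)) (inv_mem (zpow_mem (subset_closure (by simp)) _))
    · rw [← commutatorElement_eq_one_iff_commute, commutatorElement_mul_left hZ,
        commutatorElement_mul_right hZ, commutatorElement_mul_right hZ,
        commutatorElement_zpow_right hZ, commutatorElement_zpow_left hZ,
        commutatorElement_zpow_left hZ, commutatorElement_zpow_right hZ, commutatorElement_self,
        one_zpow, one_zpow, mul_one, ← commutatorElement_inv x y, inv_zpow', neg_neg,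
        ← hijk, ← hcz x y i, mul_assoc, ← hcz x z j, mul_assoc]

/-- Two generators and a central third generator yield `Q₈ × C₂`. -/
theorem nonempty_mulEquiv_quaternionGroup_prod (h : IsCritical G 1)
    (hnonab : ¬ ∀ a b : G, a * b = b * a)
    (hrank : ∀ a b : G, closure {a, b} ≠ ⊤) {x y z : G} (hgen : closure {x, y, z} = ⊤)
    (hz : z ∈ center G) :
    Nonempty (G ≃* QuaternionGroup 2 × Multiplicative (ZMod 2)) := by
  have hZ := h.commutator_le_center
  have hmem : ∀ c ∈ commutator G, c = 1 ∨ c = ⁅x, y⁆ := by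
    intro c hc
    obtain ⟨i, j, k, rfl⟩ := exists_zpow_commutatorElement hZ hgen hc
    rw [commutatorElement_of_mem_center_right hz, commutatorElement_of_mem_center_right hz,
      one_zpow, one_zpow, mul_one, mul_one]
    rcases Int.even_or_odd i with hi | hi
    · exact .inl (h.zpow_eq_one_of_even (commutatorElement_mem_commutator x y) hi)
    · exact .inr (h.zpow_eq_self_of_odd (commutatorElement_mem_commutator x y) hi)
  have hs : ⁅x, y⁆ ≠ 1 := by
    intro hs
    refine hnonab fun a b => ?_
    rw [← commutatorElement_eq_one_iff_mul_comm]
    rcases hmem _ (commutatorElement_mem_commutator a b) with h1 | h1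
    exacts [h1, h1.trans hs]
  have hx2 : x ^ 2 = ⁅x, y⁆ := (hmem _ (h.sq_mem_commutator x)).resolve_left fun h1 =>
    hs (commutatorElement_of_mem_center_left (h.mem_center_of_sq_eq_one h1) y)
  have hy2 : y ^ 2 = ⁅x, y⁆ := (hmem _ (h.sq_mem_commutator y)).resolve_left fun h1 =>
    hs (commutatorElement_of_mem_center_right (h.mem_center_of_sq_eq_one h1) x)
  -- Otherwise x² = z² with z central gives (xz)² = 1, so xz and then x are central.
  have hz2 : z ^ 2 = 1 := (hmem _ (h.sq_mem_commutator z)).resolve_right fun h1 => by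
    have hxz : (x * z) ^ 2 = 1 := by
      rw [(commute_of_mem_center hz x).symm.mul_pow, h1, hx2, ← pow_two, h.commutatorElement_sq]
    have hxzZ := h.mem_center_of_sq_eq_one hxz
    have hxZ : x ∈ center G := by
      rw [show x = x * z * z⁻¹ by group]
      exact mul_mem hxzZ (inv_mem hz)
    exact hs (commutatorElement_of_mem_center_left hxZ y)
  have hyx : ∀ m : ℕ, y * x ^ m = (x ^ m)⁻¹ * y := by
    intro m
    have h1 : y * x * y⁻¹ = x⁻¹ := by
      have h2 : x * y * x⁻¹ * y⁻¹ = x * x := by rw [← commutatorElement_def, ← hx2, pow_two]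
      have h3 : y * x⁻¹ * y⁻¹ = x := mul_left_cancel (a := x) (by rw [← h2]; group)
      calc y * x * y⁻¹ = (y * x⁻¹ * y⁻¹)⁻¹ := by group
        _ = x⁻¹ := by rw [h3]
    have h2 : y * x ^ m * y⁻¹ = (x ^ m)⁻¹ := by rw [← conj_pow, h1, inv_pow]
    rw [← h2]; group
  let e : ZMod (2 * 2) → G := fun i => x ^ i.val
  have hx4 := h.pow_four_eq_one x
  have he_add : ∀ i j, e (i + j) = e i * e j := fun i j => by
    simp only [e]
    rw [ZMod.val_add, ← pow_add]
    exact (pow_eq_pow_mod _ hx4).symm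
  have he_zero : e 0 = 1 := by simp [e]
  have he_neg : ∀ i, e (-i) = (e i)⁻¹ := fun i => eq_inv_of_mul_eq_one_left (by
    rw [← he_add, neg_add_cancel, he_zero])
  have hye : ∀ i, y * e i = e (-i) * y := fun i => by rw [he_neg]; exact hyx _
  have hyy : y * y = e 2 := by rw [← pow_two, hy2, ← hx2]; rfl
  -- The rotation `a 1` goes to x and `xa 0` to y, matching y x y⁻¹ = x⁻¹ and y² = x².
  let f : QuaternionGroup 2 → G := fun q => match q with
    | .a i => e i
    | .xa i => y * e i
  let φ₁ : QuaternionGroup 2 →* G := MonoidHom.mk' f (by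
    rintro (i | i) (j | j)
    · exact he_add i j
    · change y * e (j - i) = e i * (y * e j)
      rw [← mul_assoc, ← neg_neg i, ← hye, neg_neg, mul_assoc, ← he_add, sub_eq_add_neg, add_comm]
    · change y * e (i + j) = y * e i * e j
      rw [mul_assoc, he_add]
    · change e (2 + j - i) = y * e i * (y * e j)
      rw [hye, mul_assoc, ← mul_assoc y y, hyy, ← he_add, ← he_add]
      congr 1; ring)
  let φ₂ : Multiplicative (ZMod 2) →* G := MonoidHom.mk' (fun k => z ^ k.toAdd.val) fun i j => by
    rw [toAdd_mul, ZMod.val_add, ← pow_add]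
    exact (pow_eq_pow_mod _ hz2).symm
  have hcomm : ∀ q k, Commute (φ₁ q) (φ₂ k) := fun q k =>
    (commute_of_mem_center (pow_mem hz _) _).symm
  let φ : QuaternionGroup 2 × Multiplicative (ZMod 2) →* G := MonoidHom.noncommCoprod φ₁ φ₂ hcomm
  refine ⟨(MulEquiv.ofBijective φ ⟨?_, ?_⟩).symm⟩
  · rw [injective_iff_map_eq_one]
    have hk0 : ∀ k : Multiplicative (ZMod 2), Even ((k.toAdd.val : ℕ) : ℤ) → k = 1 := by
      intro k hk
      have h1 := ZMod.val_lt k.toAdd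
      rw [Int.even_coe_nat, Nat.even_iff] at hk
      exact toAdd_eq_zero.mp ((ZMod.val_eq_zero _).mp (by omega))
    rintro ⟨i | i, k⟩ hik
    · change x ^ i.val * z ^ k.toAdd.val = 1 at hik
      obtain ⟨hi, -, hk⟩ := h.even_of_mem_commutator hrank hgen (i := i.val) (j := 0)
        (k := k.toAdd.val)
        (by rw [zpow_zero, mul_one, zpow_natCast, zpow_natCast, hik]; exact one_mem _)
      obtain rfl := hk0 k hk
      have hxi : x ^ i.val = 1 := by simpa using hik
      have h1 := ZMod.val_lt i
      have h2 : i.val ≠ 2 := fun h2 => hs (by rw [← hx2, ← h2, hxi])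
      rw [Int.even_coe_nat, Nat.even_iff] at hi
      obtain rfl : i = 0 := (ZMod.val_eq_zero _).mp (by omega)
      rfl
    · change y * x ^ i.val * z ^ k.toAdd.val = 1 at hik
      have := (h.even_of_mem_commutator hrank (Set.insert_comm x y {z} ▸ hgen) (i := 1)
        (j := i.val) (k := k.toAdd.val)
        (by rw [zpow_one, zpow_natCast, zpow_natCast, hik]; exact one_mem _)).1
      simp at this
  · rw [← MonoidHom.range_eq_top]
    refine eq_top_of_triple hgen ⟨(.a 1, 1), ?_⟩ ⟨(.xa 0, 1), ?_⟩
      ⟨(1, .ofAdd 1), ?_⟩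
    · change x ^ 1 * z ^ 0 = x
      simp
    · change y * x ^ 0 * z ^ 0 = y
      simp
    · change x ^ 0 * z ^ 1 = z
      simp

/-- Commuting a central x^i y^j z^k c with x shows that j and k are even, and with y that i is even.
-/
lemma center_le_commutator (h : IsCritical G 1) {x y z : G} (hgen : closure {x, y, z} = ⊤)
    (hyz : Commute y z)
    (hind : ∀ i j : ℤ, ⁅x, y⁆ ^ i * ⁅x, z⁆ ^ j = 1 → Even i ∧ Even j) :
    center G ≤ commutator G := by
  have hZ := h.commutator_le_center
  intro g hg
  obtain ⟨i, j, k, c, hc, hgc⟩ := exists_zpow_mul_mem_commutator hgen g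
  have hcm : ∀ w, ⁅w, x ^ i * y ^ j * z ^ k⁆ = 1 := fun w => by
    have := commutatorElement_of_mem_center_right hg w
    rwa [hgc, commutatorElement_mul_right hZ, commutatorElement_of_mem_center_right (hZ hc),
      mul_one] at this
  have hx := hcm x
  have hy := hcm y
  rw [commutatorElement_mul_right hZ, commutatorElement_mul_right hZ,
    commutatorElement_zpow_right hZ, commutatorElement_zpow_right hZ,
    commutatorElement_zpow_right hZ, commutatorElement_self, one_zpow] at hx hy
  rw [one_mul] at hx
  rw [mul_one, commutatorElement_eq_one_iff_commute.mpr hyz, one_zpow, mul_one,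
    ← commutatorElement_inv, inv_zpow, inv_eq_one] at hy
  obtain ⟨hj, hk⟩ := hind _ _ hx
  have hi := (hind i 0 (by rw [hy, zpow_zero, one_mul])).1
  rw [hgc]
  exact mul_mem (mul_mem (mul_mem (h.zpow_mem_commutator_of_even x hi)
    (h.zpow_mem_commutator_of_even y hj)) (h.zpow_mem_commutator_of_even z hk)) hc

lemma exists_zmod_eq (h : IsCritical G 1) {a b : G} (ha : a ∈ commutator G)
    (hb : b ∈ commutator G) (i j : ℤ) :
    ∃ p : ZMod 2 × ZMod 2, a ^ i * b ^ j = a ^ p.1.val * b ^ p.2.val := by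
  have key : ∀ {a : G}, a ∈ commutator G → ∀ i : ℤ, ∃ p : ZMod 2, a ^ i = a ^ p.val := by
    intro a ha i
    rcases Int.even_or_odd i with hi | hi
    · exact ⟨0, by rw [h.zpow_eq_one_of_even ha hi]; simp⟩
    · exact ⟨1, by rw [h.zpow_eq_self_of_odd ha hi]; exact (pow_one a).symm⟩
  obtain ⟨p, hp⟩ := key ha i
  obtain ⟨q, hq⟩ := key hb j
  exact ⟨(p, q), by rw [hp, hq]⟩

set_option synthInstance.maxSize 1000 in
/-- The possible squares of the generators, in coordinates with respect to `[x, y]`, `[x, z]`. -/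
lemma squares_cases : ∀ s a b : ZMod 2 × ZMod 2, s ≠ 0 → a ≠ 0 → b ≠ 0 → a + b ≠ 0 →
    s + a + (1, 0) ≠ 0 → s + b + (0, 1) ≠ 0 → s + (a + b) + (1, 1) ≠ 0 →
    (a = (1, 0) ∧ b = (0, 1) ∧ (s = a ∨ s = b ∨ s = a + b)) ∨
    (b = (1, 0) ∧ a = (0, 1) ∧ (s = a ∨ s = b)) ∨
    (a = (1, 0) ∧ a + b = (0, 1) ∧ (s = b ∨ s = a + b)) ∨
    (a + b = (1, 0) ∧ b = (0, 1) ∧ (s = a ∨ s = a + b)) := by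
  -- Conceptually, a, b, a + b ≠ 0 makes squaring on ⟨y, z⟩ an element A of GL₂(𝔽₂), and the
  -- remaining conditions say s ∉ im(A + I). If A = I, any s ≠ 0 works; for each of the three
  -- involutions s avoids a line; for A of order 3 the image is everything.
  decide

/-- If `y` and `z` commute and their commutators with `x` are independent, then the group is one of
the two exceptional groups of order `32`. -/
theorem nonempty_mulEquiv_groupA_or_groupB (h : IsCritical G 1)
    (hrank : ∀ a b : G, closure {a, b} ≠ ⊤) {x y z : G} (hgen : closure {x, y, z} = ⊤)
    (hyz : Commute y z) (hind : ∀ i j : ℤ, ⁅x, y⁆ ^ i * ⁅x, z⁆ ^ j = 1 → Even i ∧ Even j) :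
    Nonempty (G ≃* GroupA) ∨ Nonempty (G ≃* GroupB) := by
  have hZ := h.commutator_le_center
  have hcen := h.center_le_commutator hgen hyz hind
  have hxy := commutatorElement_mem_commutator x y
  have hxz := commutatorElement_mem_commutator x z
  let E : ZMod 2 × ZMod 2 → G := fun p => ⁅x, y⁆ ^ p.1.val * ⁅x, z⁆ ^ p.2.val
  have hE_add : ∀ p q, E (p + q) = E p * E q := by
    intro p q
    have hmod : ∀ {c : G}, c ∈ commutator G → ∀ i j : ZMod 2,
        c ^ (i + j).val = c ^ i.val * c ^ j.val := fun hc i j => by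
      rw [ZMod.val_add, ← pow_add]
      exact (pow_eq_pow_mod _ (h.sq_eq_one_of_mem_commutator hc)).symm
    simp only [E, Prod.fst_add, Prod.snd_add]
    rw [hmod hxy, hmod hxz]
    exact Commute.mul_mul_mul_comm ((commute_commutatorElement hZ x y _).pow_left _) _ _
  have hE_surj : ∀ {c : G}, c ∈ commutator G → ∃ p, c = E p := by
    intro c hc
    obtain ⟨i, j, k, rfl⟩ := exists_zpow_commutatorElement hZ hgen hc
    rw [commutatorElement_eq_one_iff_commute.mpr hyz, one_zpow, mul_one]
    exact h.exists_zmod_eq hxy hxz i j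
  have hE10 : E (1, 0) = ⁅x, y⁆ := by
    change ⁅x, y⁆ ^ 1 * ⁅x, z⁆ ^ 0 = _
    simp
  have hE01 : E (0, 1) = ⁅x, z⁆ := by
    change ⁅x, y⁆ ^ 0 * ⁅x, z⁆ ^ 1 = _
    simp
  have hE11 : E (1, 1) = ⁅x, y * z⁆ := by
    rw [commutatorElement_mul_right hZ, ← hE10, ← hE01, ← hE_add]; rfl
  have hE0 : E 0 = 1 := by
    change ⁅x, y⁆ ^ 0 * ⁅x, z⁆ ^ 0 = _
    simp
  obtain ⟨s, hs⟩ := hE_surj (h.sq_mem_commutator x)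
  obtain ⟨a, ha⟩ := hE_surj (h.sq_mem_commutator y)
  obtain ⟨b, hb⟩ := hE_surj (h.sq_mem_commutator z)
  have hab : (y * z) ^ 2 = E (a + b) := by rw [hyz.mul_pow, ha, hb, hE_add]
  -- An element outside G' = Z(G) cannot have square 1. Injectivity of `E` is not needed, only E 0 =
  -- 1.
  have hne : ∀ (i j k : ℤ) (p : ZMod 2 × ZMod 2), ¬ (Even i ∧ Even j ∧ Even k) →
      (x ^ i * y ^ j * z ^ k) ^ 2 = E p → p ≠ 0 := by
    rintro i j k p hodd hp rfl
    exact hodd (h.even_of_mem_commutator hrank hgen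
      (hcen (h.mem_center_of_sq_eq_one (hp.trans hE0))))
  have hcases := squares_cases s a b (hne 1 0 0 s (by simp) (by simpa using hs))
    (hne 0 1 0 a (by simp) (by simpa using ha)) (hne 0 0 1 b (by simp) (by simpa using hb))
    (hne 0 1 1 _ (by simp) (by simpa using hab))
    (hne 1 1 0 _ (by simp) (by simp [h.mul_sq, hE_add, hs, ha, hE10]))
    (hne 1 0 1 _ (by simp) (by simp [h.mul_sq, hE_add, hs, hb, hE01]))
    (hne 1 1 1 _ (by simp) (by
      rw [zpow_one, zpow_one, zpow_one, mul_assoc, h.mul_sq, hE_add, hE_add, hab, hs, hE11]))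
  have hyyz : Commute y (y * z) := (Commute.refl y).mul_right hyz
  have hzyz : Commute z (y * z) := hyz.symm.mul_right (Commute.refl z)
  have hgen_xzy : closure {x, z, y} = ⊤ := Set.pair_comm y z ▸ hgen
  have hz_mem : z ∈ closure {x, y, y * z} := by
    rw [show z = y⁻¹ * (y * z) by group]
    exact mul_mem (inv_mem (subset_closure (by simp))) (subset_closure (by simp))
  have hgen_y : closure {x, y, y * z} = ⊤ := eq_top_of_triple hgen (subset_closure (by simp))
    (subset_closure (by simp)) hz_mem
  have hy_mem : y ∈ closure {x, z, y * z} := by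
    rw [show y = (y * z) * z⁻¹ by group]
    exact mul_mem (subset_closure (by simp)) (inv_mem (subset_closure (by simp)))
  have hgen_z : closure {x, z, y * z} = ⊤ := eq_top_of_triple hgen (subset_closure (by simp))
    hy_mem (subset_closure (by simp))
  have hgen_y' : closure {x, y * z, y} = ⊤ := Set.pair_comm y (y * z) ▸ hgen_y
  have hgen_z' : closure {x, y * z, z} = ⊤ := Set.pair_comm z (y * z) ▸ hgen_z
  have hxyz : ∀ p q, E p = ⁅x, y⁆ → E q = ⁅x, z⁆ → E (p + q) = ⁅x, y * z⁆ := fun p q hp hq => by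
    rw [hE_add, commutatorElement_mul_right hZ, hp, hq]
  have hA := fun {u v : G} => h.nonempty_mulEquiv_groupA (x := x) (y := u) (z := v) hrank hcen
  have hB := fun {u v : G} => h.nonempty_mulEquiv_groupB (x := x) (y := u) (z := v) hrank hcen
  -- The identity gives `GroupB`. In the other three cases an involution swaps two of y, z, yz, and
  -- these two, suitably ordered, serve as generators for `GroupA`.
  rcases hcases with ⟨h1, h2, h3⟩ | ⟨h1, h2, h3⟩ | ⟨h1, h2, h3⟩ | ⟨h1, h2, h3⟩ <;>
    rw [← h1] at hE10 <;> rw [← h2] at hE01 <;> have hE := hxyz _ _ hE10 hE01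
  · right
    rcases h3 with rfl | rfl | rfl
    · exact hB hgen hyz (hs.trans ha.symm) (ha.trans hE10) (hb.trans hE01)
    · exact hB hgen_xzy hyz.symm (hs.trans hb.symm) (hb.trans hE01) (ha.trans hE10)
    · exact hB hgen_z' hzyz.symm (hs.trans hab.symm) (hab.trans hE) (hb.trans hE01)
  · left
    rcases h3 with rfl | rfl
    · exact hA hgen_xzy hyz.symm (hs.trans ha.symm) (ha.trans hE01) (hb.trans hE10)
    · exact hA hgen hyz (hs.trans hb.symm) (hb.trans hE10) (ha.trans hE01)
  · left
    rw [show a + (a + b) = b by rw [← add_assoc, CharTwo.add_self_eq_zero, zero_add]] at hE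
    rcases h3 with rfl | rfl
    · exact hA hgen_z' hzyz.symm (hs.trans hb.symm) (hb.trans hE) (hab.trans hE01)
    · exact hA hgen_z hzyz (hs.trans hab.symm) (hab.trans hE01) (hb.trans hE)
  · left
    rw [show a + b + b = a by rw [add_assoc, CharTwo.add_self_eq_zero, add_zero]] at hE
    rcases h3 with rfl | rfl
    · exact hA hgen_y' hyyz.symm (hs.trans ha.symm) (ha.trans hE) (hab.trans hE10)
    · exact hA hgen_y hyyz (hs.trans hab.symm) (hab.trans hE10) (ha.trans hE)

/-- The case `r = 1` of the classification. -/
theorem classification_of_one (h : IsCritical G 1) (hnonab : ¬ ∀ a b : G, a * b = b * a)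
    (hrank : ∀ a b : G, closure {a, b} ≠ ⊤) {x y z : G} (hgen : closure {x, y, z} = ⊤) :
    Nonempty (G ≃* QuaternionGroup 2 × Multiplicative (ZMod 2)) ∨ Nonempty (G ≃* GroupA) ∨
      Nonempty (G ≃* GroupB) ∨ ∃ T : GL (Fin 3) (ZMod (2 ^ 1)), Nonempty (G ≃* GroupG 2 1 1 T) := by
  have hZ := h.commutator_le_center
  have hcm := commutatorElement_mem_commutator (G := G)
  by_cases hind : ∀ i j k : ℤ, ⁅x, y⁆ ^ i * ⁅x, z⁆ ^ j * ⁅y, z⁆ ^ k = 1 → Even i ∧ Even j ∧ Even k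
  · exact .inr (.inr (.inr (h.exists_mulEquiv_groupG_of_card hrank hgen
      (h.le_closure_of_even hgen (hcm x y) (hcm x z) (hcm y z) hind).1)))
  push Not at hind
  obtain ⟨i, j, k, hijk, hodd⟩ := hind
  obtain ⟨u, v, w, huvw, hvw⟩ := h.exists_triple_commute hgen hijk (by tauto)
  by_cases hind : ∀ i j : ℤ, ⁅u, v⁆ ^ i * ⁅u, w⁆ ^ j = 1 → Even i ∧ Even j
  · rcases h.nonempty_mulEquiv_groupA_or_groupB hrank huvw hvw hind with hA | hB
    exacts [.inr (.inl hA), .inr (.inr (.inl hB))]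
  push Not at hind
  obtain ⟨i, j, hij, hodd⟩ := hind
  left
  rcases Int.even_or_odd j with hj | hj
  · have hi : Odd i := by
      rw [← Int.not_even_iff_odd]
      exact fun hi => hodd hi hj
    rw [h.zpow_eq_one_of_even (hcm u w) hj, h.zpow_eq_self_of_odd (hcm u v) hi, mul_one,
      commutatorElement_eq_one_iff_commute] at hij
    exact h.nonempty_mulEquiv_quaternionGroup_prod hnonab hrank (Set.pair_comm v w ▸ huvw)
      (mem_center_of_triple huvw hij.symm (Commute.refl v) hvw)
  · rw [h.zpow_eq_self_of_odd (hcm u w) hj, ← commutatorElement_zpow_right hZ,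
      ← commutatorElement_mul_right hZ, commutatorElement_eq_one_iff_commute] at hij
    have hgen' : closure {u, v, v ^ i * w} = ⊤ := by
      refine eq_top_of_triple huvw (subset_closure (by simp)) (subset_closure (by simp)) ?_
      rw [show w = (v ^ i)⁻¹ * (v ^ i * w) by group]
      exact mul_mem (inv_mem (zpow_mem (subset_closure (by simp)) _)) (subset_closure (by simp))
    exact h.nonempty_mulEquiv_quaternionGroup_prod hnonab hrank hgen'
      (mem_center_of_triple huvw hij.symm (((Commute.refl v).zpow_left i).mul_left hvw.symm)
        ((hvw.zpow_left i).mul_left (Commute.refl w)))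

end IsCritical

/-! ### Reduction to critical groups and the final case split. -/

lemma isCritical_of_isPEGroup {G : Type*} [Group G] (hG : IsPEGroup 2 G) {r : ℕ}
    (hquot : Monoid.exponent (G ⧸ commutator G) = 2 ^ r)
    (hder : Monoid.exponent (commutator G) = 2 ^ r) : IsCritical G r := by
  obtain ⟨s, hs, hle⟩ := hG.omega_le_center
  obtain rfl : s = r := Nat.pow_right_injective le_rfl (hs.symm.trans hquot)
  have hc : ∀ c ∈ commutator G, c ^ 2 ^ s = 1 := fun c hc => by
    have := Monoid.pow_exponent_eq_one (⟨c, hc⟩ : commutator G)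
    rw [hder] at this
    exact congrArg Subtype.val this
  have hcen : ∀ g : G, g ^ 2 ^ s = 1 → g ∈ center G := fun g hg => hle (subset_closure hg)
  refine ⟨fun c h => hcen c (hc c h), fun g => ?_, hcen, hc⟩
  have := Monoid.pow_exponent_eq_one (g : G ⧸ commutator G)
  rw [hquot] at this
  exact (QuotientGroup.eq_one_iff _).mp this

end PEGroups

theorem theorem2p6 {G : Type*} [Group G] [Group.FG G]
    (hnonab : ¬ ∀ a b : G, a * b = b * a)
    (hgen : Group.rank G = 3)
    (hG : PEGroups.IsPEGroup 2 G)
    (r : ℕ)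
    (hquot : Monoid.exponent (G ⧸ commutator G) = 2 ^ r)
    (hder : Monoid.exponent (commutator G) = 2 ^ r) :
    Nonempty (G ≃* QuaternionGroup 2 × Multiplicative (ZMod 2)) ∨
    Nonempty (G ≃* PEGroups.GroupA) ∨
    Nonempty (G ≃* PEGroups.GroupB) ∨
    (1 ≤ r ∧ ∃ T : GL (Fin 3) (ZMod (2 ^ r)),
      Nonempty (G ≃* PEGroups.GroupG 2 r r T)) := by
  classical
  have h := PEGroups.isCritical_of_isPEGroup hG hquot hder
  obtain ⟨S, hS, hStop⟩ := Group.rank_spec G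
  rw [hgen] at hS
  obtain ⟨x, y, z, -, -, -, rfl⟩ := Finset.card_eq_three.mp hS
  have hxyz : Subgroup.closure {x, y, z} = ⊤ := by simpa using hStop
  have hrank : ∀ a b : G, Subgroup.closure {a, b} ≠ ⊤ := by
    intro a b hab
    have h1 := Group.rank_le (S := {a, b}) (by simpa using hab)
    have h2 := Finset.card_le_two (a := a) (b := b)
    omega
  have hpos : 1 ≤ r := by
    by_contra! hr
    obtain rfl : r = 0 := by omega
    rw [pow_zero, Monoid.exp_eq_one_iff] at hder
    refine hnonab fun a b => commutatorElement_eq_one_iff_mul_comm.mp ?_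
    exact congrArg Subtype.val
      (Subsingleton.elim (⟨_, PEGroups.commutatorElement_mem_commutator a b⟩ : commutator G) 1)
  rcases hpos.eq_or_lt with rfl | hr
  · rcases h.classification_of_one hnonab hrank hxyz with h1 | h1 | h1 | h1
    exacts [.inl h1, .inr (.inl h1), .inr (.inr (.inl h1)), .inr (.inr (.inr ⟨le_rfl, h1⟩))]
  · refine .inr (.inr (.inr ⟨hpos, h.exists_mulEquiv_groupG_of_two_le hr ?_ hxyz⟩))
    -- An exponent of exactly 2^r provides an element of G' not killed by 2^(r-1).
    by_contra! hall
    have hdvd := Monoid.exponent_dvd_of_forall_pow_eq_one (G := commutator G) (n := 2 ^ (r - 1))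
      fun c => Subtype.ext (hall c c.2)
    rw [hder, Nat.pow_dvd_pow_iff_le_right one_lt_two] at hdvd
    omega
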